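/- Let $\langle z,w\rangle=z_1\overline{w_3}+z_2\overline{w_2}+z_3\overline{w_1}$ on $\mathbb{C}^3$ (a Hermitian form of signature $(2,1)$), let $\mathrm{SU}(2,1)$ be the group of determinant-one matrices preserving it, $\mathrm{PU}(2,1)$ the group of projective transformations it induces, and $\partial\mathbb{H}^2_{\mathbb{C}}\subset\mathbb{CP}^2$ the set of null points (a sphere $S^3$). An element of $\mathrm{PU}(2,1)$ is *parabolic* if it fixes exactly one point of $\partial\mathbb{H}^2_{\mathbb{C}}$. For a subgroup $\Gamma\subset\mathrm{PU}(2,1)$ let $\widetilde\Gamma\subset\mathrm{SU}(2,1)$ be the group of all lifts of elements of $\Gamma$, let $\widetilde\Gamma^{(3)}$ be the subgroup generated by the cubes of elements of $\widetilde\Gamma$, and let $k(\Gamma)=\mathbb{Q}(\mathrm{Tr}\,g : g\in\widetilde\Gamma^{(3)})$. The group $\Gamma$ is *Zariski dense* if it is so in the real algebraic group $\mathrm{PU}(2,1)$, i.e. if every real polynomial in the real and imaginary parts of the matrix entries that vanishes on $\widetilde\Gamma$ vanishes on $\mathrm{SU}(2,1)$. For a quadruple $(p_0,p_1,p_2,p_3)$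 of points of $\partial\mathbb{H}^2_{\mathbb{C}}$ in generic position (no three on the boundary of a common complex line) and an ordering $(i,j,k,l)$ of its indices, let $z_{(i,j,k,l)}$ be the cross-ratio, normalised so that the cross-ratio of $\infty,0,1,z$ is $z$, of the following four points of the projective line of complex lines through $p_i$: the complex line tangent to $\partial\mathbb{H}^2_{\mathbb{C}}$ at $p_i$, and the complex lines through $p_i$ and $p_j$, $p_k$, $p_l$ respectively. The invariants of the quadruple are $z_{(0,1,2,3)}$, $z_{(1,0,3,2)}$, $z_{(2,3,0,1)}$, $z_{(3,2,1,0)}$. Let $M$ be a connected oriented $3$-manifold which is the interior of a compact manifold whose boundary is a non-empty union of tori, with an ideal triangulation, that is, a presentation of $M$ as a finite collection of tetrahedra without their vertices, glued along their faces in pairs by orientation-reversing affine maps. Let the triangulation be realized in $\partial\mathbb{H}^2_{\mathbb{C}}$: each tetrahedron is assigned a quadruple of points of $\partial\mathbb{H}^2_{\mathbb{C}}$ in generic position, each face gluing is induced on the vertices of the face by an element of $\mathrm{PU}(2,1)$ (its face-pairing), and the quadruples are placed as the pieces of one developed polyhedron, i.e. any two of them are joined by a chain of tetrahedra in which consecutive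 ones are glued along a face whose face-pairing is the identity. Let $\rho:\pi_1(M)\to\mathrm{PU}(2,1)$ be a representation compatible with the triangulation, i.e. $\Gamma=\rho(\pi_1(M))$ is the group generated by the face-pairings. Let $k_\Delta\subset\mathbb{C}$ be the field generated over $\mathbb{Q}$ by the invariants of all the tetrahedra. Then: 1. $k(\Gamma)\subset k_\Delta$. 2. If moreover every vertex of the realized tetrahedra is fixed by some parabolic element of $\Gamma$, and $\Gamma$ is Zariski dense, then $k_\Delta=k(\Gamma)$. -/

import Mathlib

open scoped Matrix LinearAlgebra.Projectivization ComplexConjugate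

noncomputable section

/-! ### The Siegel model of complex hyperbolic plane, `SU(2,1)` and `PU(2,1)` -/

/-- The Gram matrix of the Hermitian form of signature `(2,1)`. -/
def siegelJ : Matrix (Fin 3) (Fin 3) ℂ := !![0, 0, 1; 0, 1, 0; 1, 0, 0]

/-- The Hermitian form `⟨z, w⟩ = z₁ w̄₃ + z₂ w̄₂ + z₃ w̄₁`, linear in the first variable and
antilinear in the second. -/
def herm (z w : Fin 3 → ℂ) : ℂ := z 0 * conj (w 2) + z 1 * conj (w 1) + z 2 * conj (w 0)

theorem herm_eq (z w : Fin 3 → ℂ) : herm z w = star w ⬝ᵥ (siegelJ *ᵥ z) := by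
  simp [herm, siegelJ, dotProduct, Matrix.mulVec, Fin.sum_univ_three]
  ring

theorem herm_smul_smul (a b : ℂ) (z w : Fin 3 → ℂ) :
    herm (a • z) (b • w) = a * conj b * herm z w := by
  simp [herm]
  ring

theorem conj_herm (z w : Fin 3 → ℂ) : conj (herm z w) = herm w z := by
  simp [herm]
  ring

/-- The group `SU(2,1)` of matrices of determinant `1` that preserve the Hermitian form. -/
def SU21 : Subgroup (Matrix.SpecialLinearGroup (Fin 3) ℂ) where
  carrier := {A | A.1ᴴ * siegelJ * A.1 = siegelJ}
  one_mem' := by simp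
  mul_mem' := by
    intro A B hA hB
    simp only [Set.mem_ofPred_eq, Matrix.SpecialLinearGroup.coe_mul,
      Matrix.conjTranspose_mul] at hA hB ⊢
    calc B.1ᴴ * A.1ᴴ * siegelJ * (A.1 * B.1) = B.1ᴴ * (A.1ᴴ * siegelJ * A.1) * B.1 := by
          simp only [Matrix.mul_assoc]
      _ = siegelJ := by rw [hA, hB]
  inv_mem' := by
    intro A hA
    simp only [Set.mem_ofPred_eq] at hA ⊢
    have h1 : A.1 * (A⁻¹).1 = 1 := by
      rw [← Matrix.SpecialLinearGroup.coe_mul, mul_inv_cancel, Matrix.SpecialLinearGroup.coe_one]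
    have h2 : (A⁻¹).1ᴴ * A.1ᴴ = 1 := by
      rw [← Matrix.conjTranspose_mul, h1, Matrix.conjTranspose_one]
    calc (A⁻¹).1ᴴ * siegelJ * (A⁻¹).1
        = (A⁻¹).1ᴴ * (A.1ᴴ * siegelJ * A.1) * (A⁻¹).1 := by rw [hA]
      _ = ((A⁻¹).1ᴴ * A.1ᴴ) * siegelJ * (A.1 * (A⁻¹).1) := by simp only [Matrix.mul_assoc]
      _ = siegelJ := by rw [h1, h2, Matrix.one_mul, Matrix.mul_one]

/-- The group `PU(2,1)`, as the group of the transformations of the complex projective plane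
that are induced by elements of `SU(2,1)`. -/
def PU21 : Subgroup (Equiv.Perm (ℙ ℂ (Fin 3 → ℂ))) :=
  (MulAction.toPermHom SU21 (ℙ ℂ (Fin 3 → ℂ))).range

/-- The projection `SU(2,1) → PU(2,1)`. -/
def toPU21 : SU21 →* PU21 := (MulAction.toPermHom SU21 (ℙ ℂ (Fin 3 → ℂ))).rangeRestrict

/-- The boundary of the complex hyperbolic plane (the sphere `S³`): the points of the
projective plane represented by null vectors. -/
def HBoundary : Type := {p : ℙ ℂ (Fin 3 → ℂ) // herm p.rep p.rep = 0}

/-- An element of `PU(2,1)` is parabolic if it fixes exactly one point of the boundary. -/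
def IsParabolic (γ : PU21) : Prop := ∃! p : HBoundary, γ • p.1 = p.1

/-- `p` is fixed by some parabolic element of `Γ`. -/
def IsParabolicFixedPoint (Γ : Subgroup PU21) (p : HBoundary) : Prop :=
  ∃ γ ∈ Γ, IsParabolic γ ∧ γ • p.1 = p.1

/-! ### Trace fields and Zariski density -/

/-- The group of all lifts to `SU(2,1)` of the elements of `Γ`. -/
def lifts (Γ : Subgroup PU21) : Subgroup SU21 := Γ.comap toPU21

/-- The field `ℚ(Tr g : g ∈ G)`. -/
def traceField (G : Subgroup SU21) : IntermediateField ℚ ℂ :=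
  IntermediateField.adjoin ℚ {x | ∃ g ∈ G, x = Matrix.trace g.1.1}

/-- The subgroup generated by the cubes of the elements of `G`. -/
def cubeSubgroup (G : Subgroup SU21) : Subgroup SU21 :=
  Subgroup.closure {x | ∃ g ∈ G, x = g ^ 3}

/-- The field `k(Γ)`: the trace field of the subgroup generated by the cubes of the lifts. -/
def cubeTraceField (Γ : Subgroup PU21) : IntermediateField ℚ ℂ :=
  traceField (cubeSubgroup (lifts Γ))

/-- The real and imaginary parts of the entries of an element of `SU(2,1)`. -/
def realCoords (g : SU21) : (Fin 3 × Fin 3) ⊕ (Fin 3 × Fin 3) → ℝ :=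
  Sum.elim (fun p => (g.1.1 p.1 p.2).re) (fun p => (g.1.1 p.1 p.2).im)

/-- `Γ` is Zariski dense in the real algebraic group `PU(2,1)`, that is, its full preimage is
Zariski dense in `SU(2,1)`: a real polynomial in the real and imaginary parts of the matrix
entries which vanishes on all lifts of elements of `Γ` vanishes on `SU(2,1)`. -/
def IsZariskiDense (Γ : Subgroup PU21) : Prop :=
  ∀ f : MvPolynomial ((Fin 3 × Fin 3) ⊕ (Fin 3 × Fin 3)) ℝ,
    (∀ g ∈ lifts Γ, MvPolynomial.eval (realCoords g) f = 0) →
      ∀ g : SU21, MvPolynomial.eval (realCoords g) f = 0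

/-! ### Generic quadruples and their cross-ratio invariants -/

/-- `p`, `q`, `r` lie on a common `ℂ`-circle, i.e. on the boundary of a complex line; `c` is a
polar vector of that line. -/
def OnCommonCCircle (p q r : HBoundary) : Prop :=
  ∃ c : Fin 3 → ℂ, 0 < (herm c c).re ∧
    herm p.1.rep c = 0 ∧ herm q.1.rep c = 0 ∧ herm r.1.rep c = 0

/-- No three of the four points lie on a common `ℂ`-circle. -/
def GenericPosition (p : Fin 4 → HBoundary) : Prop :=
  ∀ i j k : Fin 4, i ≠ j → j ≠ k → i ≠ k → ¬ OnCommonCCircle (p i) (p j) (p k)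

/-- The determinant with rows `u`, `v`, `w`. -/
def det3 (u v w : Fin 3 → ℂ) : ℂ := Matrix.det !![u 0, u 1, u 2; v 0, v 1, v 2; w 0, w 1, w 2]

/-- A polar vector of the complex line through the points represented by `p` and `q`:
the vector `c` with `⟨x, c⟩ = det (p, q, x)` for all `x`. -/
def polar (p q : Fin 3 → ℂ) : Fin 3 → ℂ :=
  ![conj ((p ⨯₃ q) 2), conj ((p ⨯₃ q) 1), conj ((p ⨯₃ q) 0)]

theorem herm_polar (x p q : Fin 3 → ℂ) : herm x (polar p q) = det3 p q x := by
  simp [herm, polar, det3, cross_apply, Matrix.det_fin_three]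
  ring

theorem herm_polar_left (p q : Fin 3 → ℂ) : herm p (polar p q) = 0 := by
  rw [herm_polar]
  simp [det3, Matrix.det_fin_three]
  ring

theorem herm_polar_right (p q : Fin 3 → ℂ) : herm q (polar p q) = 0 := by
  rw [herm_polar]
  simp [det3, Matrix.det_fin_three]
  ring

/-- In particular the polar vector is positive when `p` and `q` represent distinct null points. -/
theorem herm_polar_polar (p q : Fin 3 → ℂ) :
    herm (polar p q) (polar p q) = herm p q * herm q p - herm p p * herm q q := by
  simp [herm, polar, cross_apply]
  ring

/-- The cross-ratio of the four complex lines through `p` and `a`, `b`, `c`, `d`, seen as points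
of the projective line of all complex lines through `p`; it is normalised so that the cross-ratio
of `∞, 0, 1, z` is `z`. -/
def pencilCrossRatio (p a b c d : Fin 3 → ℂ) : ℂ :=
  (det3 p b d * det3 p a c) / (det3 p b c * det3 p a d)

/-- The invariant at the vertex `p` of the quadruple `(p, q, r, s)`: the cross-ratio of
`c', q', r', s'`, where `q'`, `r'`, `s'` are the complex lines through `p` and `q`, `r`, `s`, and
`c'` is the complex line through `p` tangent to the sphere, that is, the projectivization of
`p^⊥`, which is spanned by `p` and `polar p q`. -/
def vertexInvariant (p q r s : Fin 3 → ℂ) : ℂ := pencilCrossRatio p (polar p q) q r s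

/-- The complex line through a null `p` and `polar p q` is the tangent one: it consists of the
points represented by vectors orthogonal to `p`. -/
theorem det3_polar (p q x : Fin 3 → ℂ) (hp : herm p p = 0) :
    det3 p (polar p q) x = - herm p q * herm x p := by
  have key : det3 p (polar p q) x = herm p p * herm x q - herm p q * herm x p := by
    simp [herm, polar, det3, cross_apply, Matrix.det_fin_three]
    ring
  rw [key, hp]
  ring

/-- The expression of the invariant through the Hermitian form and polar vectors. -/
theorem vertexInvariant_eq (p q r s : Fin 3 → ℂ) (hp : herm p p = 0) (hpq : herm p q ≠ 0) :
    vertexInvariant p q r s =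
      (herm s (polar p q) * herm r p) / (herm r (polar p q) * herm s p) := by
  rw [vertexInvariant, pencilCrossRatio, det3_polar p q r hp, det3_polar p q s hp, herm_polar,
    herm_polar,
    show det3 p q s * (-herm p q * herm r p) = (-herm p q) * (det3 p q s * herm r p) by ring,
    show det3 p q r * (-herm p q * herm s p) = (-herm p q) * (det3 p q r * herm s p) by ring,
    mul_div_mul_left _ _ (neg_ne_zero.mpr hpq)]

/-- The four cross-ratio invariants of a quadruple of boundary points. -/
def tetInvariants (p : Fin 4 → HBoundary) : Fin 4 → ℂ :=
  let v : Fin 4 → Fin 3 → ℂ := fun i => (p i).1.rep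
  ![vertexInvariant (v 0) (v 1) (v 2) (v 3), vertexInvariant (v 1) (v 0) (v 3) (v 2),
    vertexInvariant (v 2) (v 3) (v 0) (v 1), vertexInvariant (v 3) (v 2) (v 1) (v 0)]

/-! ### Ideal triangulations -/

/-- Gluing data for tetrahedra indexed by `τ`. Each tetrahedron has vertices `Fin 4`, and its
face `i` is the one opposite to the vertex `i`. Face `i` of `t` is glued to the face
`perm t i i` of `nbr t i` by the affine map that sends the vertex `v ≠ i` to `perm t i v`. -/
structure FaceGluing (τ : Type*) where
  nbr : τ → Fin 4 → τ
  perm : τ → Fin 4 → Equiv.Perm (Fin 4)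
  /-- The face gluings are mutually inverse. -/
  nbr_nbr : ∀ t i, nbr (nbr t i) (perm t i i) = t
  perm_nbr : ∀ t i, perm (nbr t i) (perm t i i) = (perm t i)⁻¹
  /-- No face is glued to itself. -/
  ne_self : ∀ t i, (nbr t i, perm t i i) ≠ (t, i)

namespace FaceGluing

variable {τ : Type*} (T : FaceGluing τ)

/-- The ideal vertices: classes of corners `(t, v)`. -/
def Vertex : Type _ :=
  Quot fun a b : τ × Fin 4 => ∃ i, i ≠ a.2 ∧ b = (T.nbr a.1 i, T.perm a.1 i a.2)

/-- Directed edges `(t, v, w)`, from `v` to `w`, of the separate tetrahedra. -/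
def PreEdge (τ : Type*) : Type _ := {x : τ × Fin 4 × Fin 4 // x.2.1 ≠ x.2.2}

/-- The directed edges of the triangulation. -/
def DirEdge : Type _ :=
  Quot fun a b : PreEdge τ => ∃ i, i ≠ a.1.2.1 ∧ i ≠ a.1.2.2 ∧
    b.1 = (T.nbr a.1.1 i, T.perm a.1.1 i a.1.2.1, T.perm a.1.1 i a.1.2.2)

/-- The initial vertex of a directed edge. -/
def DirEdge.origin : T.DirEdge → T.Vertex :=
  Quot.lift (fun a => Quot.mk _ (a.1.1, a.1.2.1)) (by
    rintro a b ⟨i, hi, -, hb⟩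
    refine Quot.sound ⟨i, hi, ?_⟩
    simp [hb])

/-- The link of the vertex `c` has Euler characteristic `0`. The link is a closed surface,
triangulated with one triangle for each corner at `c` and one vertex for each directed edge
starting at `c`; as `2 E = 3 F`, the equation `V - E + F = 0` is `2 V = F`. For oriented gluings
this says that the link is a torus. -/
def LinkIsTorus (c : T.Vertex) : Prop :=
  2 * Nat.card {e : T.DirEdge // e.origin = c} =
    Nat.card {x : τ × Fin 4 // (Quot.mk _ x : T.Vertex) = c}

/-- A tetrahedron with its vertices removed, in barycentric coordinates. -/
def IdealTetrahedron : Type := {x : Fin 4 → ℝ // x ∈ stdSimplex ℝ (Fin 4) ∧ ∀ v, x v ≠ 1}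

instance : TopologicalSpace IdealTetrahedron :=
  inferInstanceAs (TopologicalSpace {x : Fin 4 → ℝ // x ∈ stdSimplex ℝ (Fin 4) ∧ ∀ v, x v ≠ 1})

/-- The space obtained from the disjoint union of the ideal tetrahedra by gluing the faces. -/
def Space : Type _ :=
  Quot fun a b : (Σ _ : τ, IdealTetrahedron) =>
    ∃ i, a.2.1 i = 0 ∧ b.1 = T.nbr a.1 i ∧ ∀ v, b.2.1 (T.perm a.1 i v) = a.2.1 v

instance : TopologicalSpace T.Space :=
  inferInstanceAs (TopologicalSpace (Quot _))

end FaceGluing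

/-- An ideal triangulation of a connected oriented `3`-manifold which is the interior of a compact
manifold whose boundary is a union of tori (for finite `τ`); the manifold is `Space`. -/
structure IdealTriangulation (τ : Type*) extends FaceGluing τ where
  /-- The gluing maps reverse the orientation of the faces. -/
  oriented : ∀ t i, Equiv.Perm.sign (perm t i) = -1
  connected : ∀ t t', Relation.ReflTransGen (fun a b => ∃ i, nbr a i = b) t t'
  linkIsTorus : ∀ c : toFaceGluing.Vertex, toFaceGluing.LinkIsTorus c

namespace IdealTriangulation

variable {τ : Type*}

/-- A realization in the boundary of the complex hyperbolic plane: every tetrahedron becomes a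
generic quadruple of boundary points and every face gluing is induced by an element of `PU(2,1)`.
The quadruples are placed as the pieces of one developed polyhedron: any two of them are joined
by a chain of quadruples in which consecutive ones are glued along a common face by the
identity. -/
structure Realization (T : IdealTriangulation τ) where
  vertex : τ → Fin 4 → HBoundary
  generic : ∀ t, GenericPosition (vertex t)
  pairing : τ → Fin 4 → PU21
  pairing_smul : ∀ t i v, v ≠ i →
    pairing t i • (vertex t v).1 = (vertex (T.nbr t i) (T.perm t i v)).1
  developed : ∀ t t', Relation.ReflTransGen (fun a b => ∃ i, T.nbr a i = b ∧ pairing a i = 1) t t'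

variable {T : IdealTriangulation τ}

/-- A representation of the fundamental group is compatible with the realized triangulation if
its image is the group generated by the face-pairings. -/
def Realization.IsCompatible (R : T.Realization) {x₀ : T.Space}
    (ρ : FundamentalGroup T.Space x₀ →* PU21) : Prop :=
  ρ.range = Subgroup.closure {g | ∃ t i, g = R.pairing t i}

/-- The field `k_Δ` generated by the invariants of all the tetrahedra. -/
def Realization.invariantField (R : T.Realization) : IntermediateField ℚ ℂ :=
  IntermediateField.adjoin ℚ {x | ∃ t j, x = tetInvariants (R.vertex t) j}

end IdealTriangulation

end

/-!
Write `k` for the field of the invariants and `F` for the trace field `k(Γ)`.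

**The inclusion of `F` in `k`.** Four generic points form a projective frame, hence span a `k`-form
`L` of `ℂ³` in which they are rational. The invariant at a vertex is a cross-ratio of the tangent
line and of the lines to the other vertices. So if the four vertices of a tetrahedron are rational,
its invariants make the four tangent lines rational (`DetRational.isRationalTangent`). Conversely,
if three vertices are rational together with their tangent lines, the invariants at two of them
determine the lines from there to the fourth vertex, which is thereby rational
(`isRationalPoint_of_vertexInvariant`). Along chains of tetrahedra glued by the identity, all
vertices and tangent lines are rational for one and the same `L`
(`IdealTriangulation.Realization.exists_rational`). An isometry that takes three rational points
with rational tangent lines to three such points preserves `L` up to a scalar `m`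
(`DetRational.preservesUpToScalar`). This holds for the lifts of all face-pairings, and so for all
lifts of elements of `Γ`. As the determinant is `1`, the cube of `m` is in `k`, so the cubes of the
lifts preserve `L` itself and the traces of their products are in `k`.

**The inclusion of `k` in `F`.** Let `p` be the fixed point of a parabolic element with lift `g`. As
`g` is not diagonalizable, neither is `g ^ 3`, and its characteristic polynomial has coefficients in
`F`. So the algebra `F[g ^ 3]` is not reduced, and it contains a square-zero element `E ≠ 0`
(`exists_aeval_sq_eq_zero`). It has rank one. The images of `E` and of its adjoint are null lines
fixed by `g`, hence both equal to the line of `p`, so `E` is a multiple of `x ↦ ⟨x, p⟩ p`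
(`IsUniqueNullEigenvector.exists_eq_smul_hermDyad`). Thus the `F`-algebra generated by the cubes of
the lifts contains multiples of these dyads for all vertices `p`. As all its elements have trace in
`F`, the products `⟨p, q⟩⟨q, p⟩` and `⟨p, q⟩⟨q, r⟩⟨r, p⟩` are in `F` up to factors that depend on
`p`, `q`, `r` multiplicatively. By a Gram determinant, the invariants are quotients of sums of such
products along cycles, in which the factors cancel (`vertexInvariant_eq_cycles`).
-/

/-! ### The Hermitian form and determinants -/

theorem herm_add_left (x y z : Fin 3 → ℂ) : herm (x + y) z = herm x z + herm y z := by
  simp [herm]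
  ring

theorem herm_add_right (x y z : Fin 3 → ℂ) : herm x (y + z) = herm x y + herm x z := by
  simp [herm]
  ring

theorem herm_smul_left (a : ℂ) (x y : Fin 3 → ℂ) : herm (a • x) y = a * herm x y := by
  simp [herm]
  ring

theorem herm_smul_right (a : ℂ) (x y : Fin 3 → ℂ) : herm x (a • y) = conj a * herm x y := by
  simp [herm]
  ring

theorem herm_eq_zero_comm {x y : Fin 3 → ℂ} : herm x y = 0 ↔ herm y x = 0 := by
  rw [← conj_herm x y, map_eq_zero]

/-- The Hermitian form is nondegenerate. -/
theorem eq_zero_of_herm_eq_zero {x : Fin 3 → ℂ} (h : ∀ y, herm x y = 0) : x = 0 := by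
  have h0 := h ![0, 0, 1]
  have h1 := h ![0, 1, 0]
  have h2 := h ![1, 0, 0]
  simp only [herm, Matrix.cons_val, map_zero, map_one] at h0 h1 h2
  ext i
  fin_cases i <;> simp_all

theorem det3_eq (u v w : Fin 3 → ℂ) :
    det3 u v w = u 0 * v 1 * w 2 - u 0 * v 2 * w 1 - u 1 * v 0 * w 2 + u 1 * v 2 * w 0
      + u 2 * v 0 * w 1 - u 2 * v 1 * w 0 := by
  simp [det3, Matrix.det_fin_three]

/-- Cramer's rule. -/
theorem det3_smul_eq (u v w x : Fin 3 → ℂ) :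
    det3 u v w • x = det3 x v w • u + det3 u x w • v + det3 u v x • w := by
  ext i
  fin_cases i <;> simp [det3_eq] <;> ring

theorem det3_smul_smul_smul (a b c : ℂ) (u v w : Fin 3 → ℂ) :
    det3 (a • u) (b • v) (c • w) = a * b * c * det3 u v w := by
  simp [det3_eq]
  ring

theorem det3_mulVec (A : Matrix (Fin 3) (Fin 3) ℂ) (u v w : Fin 3 → ℂ) :
    det3 (A *ᵥ u) (A *ᵥ v) (A *ᵥ w) = A.det * det3 u v w := by
  simp [det3_eq, Matrix.det_fin_three, Matrix.mulVec, dotProduct, Fin.sum_univ_three]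
  ring

/-- The trace is the derivative of the determinant at the identity. -/
theorem trace_mul_det3 (A : Matrix (Fin 3) (Fin 3) ℂ) (u v w : Fin 3 → ℂ) :
    A.trace * det3 u v w =
      det3 (A *ᵥ u) v w + det3 u (A *ᵥ v) w + det3 u v (A *ᵥ w) := by
  simp [det3_eq, Matrix.trace, Matrix.mulVec, dotProduct, Fin.sum_univ_three]
  ring

theorem det3_swap_left (u v w : Fin 3 → ℂ) : det3 v u w = -det3 u v w := by
  simp [det3_eq]
  ring

theorem det3_swap_right (u v w : Fin 3 → ℂ) : det3 u w v = -det3 u v w := by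
  simp [det3_eq]
  ring

/-- The determinant of a Gram matrix. The sign is the determinant of `siegelJ`. -/
theorem det3_mul_conj_det3 (u v w x y z : Fin 3 → ℂ) :
    det3 u v w * conj (det3 x y z) = -Matrix.det !![herm u x, herm u y, herm u z;
      herm v x, herm v y, herm v z; herm w x, herm w y, herm w z] := by
  simp only [det3_eq, herm, Matrix.det_fin_three, Matrix.of_apply, Matrix.cons_val, map_add,
    map_sub, map_mul]
  ring

/-- Orthogonal null vectors are proportional. -/
theorem det3_eq_zero_of_herm_eq_zero {p q : Fin 3 → ℂ} (hp : herm p p = 0) (hq : herm q q = 0)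
    (hpq : herm p q = 0) (x : Fin 3 → ℂ) : det3 p q x = 0 := by
  have h := det3_mul_conj_det3 p q x p q x
  have hqp := herm_eq_zero_comm.1 hpq
  simpa [Matrix.det_fin_three, hp, hq, hpq, hqp] using h

theorem det3_eq_zero_of_herm_eq_zero' {p q : Fin 3 → ℂ} (hp : herm p p = 0) (hq : herm q q = 0)
    (hpq : herm p q = 0) (x : Fin 3 → ℂ) : det3 p x q = 0 := by
  rw [det3_swap_right, det3_eq_zero_of_herm_eq_zero hp hq hpq, neg_zero]

theorem herm_ne_zero_of_det3_ne_zero {p q r : Fin 3 → ℂ} (hp : herm p p = 0) (hq : herm q q = 0)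
    (h : det3 p q r ≠ 0) : herm p q ≠ 0 :=
  fun hpq => h (det3_eq_zero_of_herm_eq_zero hp hq hpq r)

theorem herm_polar_polar_re_pos {p q : Fin 3 → ℂ} (hp : herm p p = 0) (hpq : herm p q ≠ 0) :
    0 < (herm (polar p q) (polar p q)).re := by
  rw [herm_polar_polar, hp, zero_mul, sub_zero, ← conj_herm p q, Complex.mul_conj,
    Complex.ofReal_re]
  exact Complex.normSq_pos.2 hpq

/-- A null vector is not orthogonal to both isotropic vectors of the standard basis. -/
theorem exists_null_herm_ne_zero {p : Fin 3 → ℂ} (hp : herm p p = 0) (h0 : p ≠ 0) :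
    ∃ e, herm e e = 0 ∧ herm p e ≠ 0 := by
  by_contra! h
  have h1 := h ![1, 0, 0] (by simp [herm])
  have h2 := h ![0, 0, 1] (by simp [herm])
  simp only [herm, Matrix.cons_val, map_zero, map_one] at h1 h2
  have h3 : p 2 = 0 := by simpa using h1
  have h4 : p 0 = 0 := by simpa using h2
  have h5 : p 1 = 0 := by simpa [herm, h3, h4] using hp
  exact h0 (by ext i; fin_cases i <;> simp [h3, h4, h5])

/-! ### Generic quadruples -/

theorem HBoundary.herm_self (p : HBoundary) : herm p.1.rep p.1.rep = 0 := p.2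

theorem HBoundary.rep_ne_zero (p : HBoundary) : p.1.rep ≠ 0 := p.1.rep_nonzero

/-- Linearly dependent boundary points lie on a common `ℂ`-circle. This includes coinciding
points, for which any complex line through them will do. -/
theorem onCommonCCircle_of_det3_eq_zero {p q r : HBoundary}
    (h : det3 p.1.rep q.1.rep r.1.rep = 0) : OnCommonCCircle p q r := by
  have hp := p.herm_self
  have hq := q.herm_self
  have hr := r.herm_self
  by_cases hpq : herm p.1.rep q.1.rep = 0
  · by_cases hpr : herm p.1.rep r.1.rep = 0
    · obtain ⟨e, he, hpe⟩ := exists_null_herm_ne_zero hp p.rep_ne_zero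
      refine ⟨polar p.1.rep e, herm_polar_polar_re_pos hp hpe, herm_polar_left _ _, ?_, ?_⟩
      · rw [herm_polar, det3_eq_zero_of_herm_eq_zero' hp hq hpq]
      · rw [herm_polar, det3_eq_zero_of_herm_eq_zero' hp hr hpr]
    · refine ⟨polar p.1.rep r.1.rep, herm_polar_polar_re_pos hp hpr, herm_polar_left _ _, ?_,
        herm_polar_right _ _⟩
      rw [herm_polar, det3_swap_right, h, neg_zero]
  · refine ⟨polar p.1.rep q.1.rep, herm_polar_polar_re_pos hp hpq, herm_polar_left _ _,
      herm_polar_right _ _, ?_⟩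
    rw [herm_polar, h]

theorem GenericPosition.det3_ne_zero {p : Fin 4 → HBoundary} (h : GenericPosition p)
    {i j k : Fin 4} (hij : i ≠ j) (hjk : j ≠ k) (hik : i ≠ k) :
    det3 (p i).1.rep (p j).1.rep (p k).1.rep ≠ 0 :=
  fun h0 => h i j k hij hjk hik (onCommonCCircle_of_det3_eq_zero h0)

theorem GenericPosition.herm_ne_zero {p : Fin 4 → HBoundary} (h : GenericPosition p)
    {i j : Fin 4} (hij : i ≠ j) : herm (p i).1.rep (p j).1.rep ≠ 0 := by
  obtain ⟨k, hjk, hik⟩ : ∃ k, j ≠ k ∧ i ≠ k := by decide +revert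
  exact herm_ne_zero_of_det3_ne_zero (p i).herm_self (p j).herm_self (h.det3_ne_zero hij hjk hik)

/-- The vertex invariant in terms of determinants and the Hermitian form. -/
theorem vertexInvariant_eq_det3 {p q r s : Fin 3 → ℂ} (hp : herm p p = 0) (hpq : herm p q ≠ 0) :
    vertexInvariant p q r s = (det3 p q s * herm r p) / (det3 p q r * herm s p) := by
  rw [vertexInvariant_eq p q r s hp hpq, herm_polar, herm_polar]

theorem vertexInvariant_swap_right {p q r s : Fin 3 → ℂ} (hp : herm p p = 0)
    (hpq : herm p q ≠ 0) : vertexInvariant p q s r = (vertexInvariant p q r s)⁻¹ := by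
  rw [vertexInvariant_eq_det3 hp hpq, vertexInvariant_eq_det3 hp hpq, inv_div]

theorem vertexInvariant_swap_left {p q r s : Fin 3 → ℂ} (hp : herm p p = 0)
    (hpq : herm p q ≠ 0) (hpr : herm p r ≠ 0) (hps : herm p s ≠ 0) (hD : det3 p q r ≠ 0) :
    vertexInvariant p r q s = 1 - vertexInvariant p q r s := by
  have hsp : herm s p ≠ 0 := fun h => hps (herm_eq_zero_comm.1 h)
  rw [vertexInvariant_eq_det3 hp hpq, vertexInvariant_eq_det3 hp hpr, det3_swap_right p q r]
  field_simp
  have key := congrArg (herm · p) (det3_smul_eq p q r s)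
  simp only [herm_add_left, herm_smul_left, hp] at key
  rw [det3_swap_right p r s] at key
  linear_combination -key

theorem vertexInvariant_smul {a b c d : ℂ} (ha : a ≠ 0) (hb : b ≠ 0) (hc : c ≠ 0) (hd : d ≠ 0)
    {p q r s : Fin 3 → ℂ} (hp : herm p p = 0) (hpq : herm p q ≠ 0) :
    vertexInvariant (a • p) (b • q) (c • r) (d • s) = vertexInvariant p q r s := by
  have ha' : conj a ≠ 0 := by simpa using ha
  have hb' : conj b ≠ 0 := by simpa using hb
  rw [vertexInvariant_eq_det3 hp hpq, vertexInvariant_eq_det3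
    (by rw [herm_smul_smul, hp, mul_zero])
    (by rw [herm_smul_smul]; exact mul_ne_zero (mul_ne_zero ha hb') hpq)]
  rw [det3_smul_smul_smul, det3_smul_smul_smul, herm_smul_smul, herm_smul_smul,
    show a * b * d * det3 p q s * (c * conj a * herm r p) =
      (a * b * c * d * conj a) * (det3 p q s * herm r p) by ring,
    show a * b * c * det3 p q r * (d * conj a * herm s p) =
      (a * b * c * d * conj a) * (det3 p q r * herm s p) by ring]
  exact mul_div_mul_left _ _ (by simp [*])

/-! ### Rational structures -/

section Rational

variable {k : IntermediateField ℚ ℂ} {L : Submodule k (Fin 3 → ℂ)}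

/-- `L` is a `k`-form of a subspace of `ℂ³`, in the sense that the determinants of triples of
vectors in `L` have their ratios in `k`. A ratio with denominator `0` is `0`, which is harmless. -/
def DetRational (L : Submodule k (Fin 3 → ℂ)) : Prop :=
  ∀ u ∈ L, ∀ v ∈ L, ∀ w ∈ L, ∀ x ∈ L, ∀ y ∈ L, ∀ z ∈ L, det3 x y z / det3 u v w ∈ k

/-- The point represented by `p` is rational for the `k`-form `L`. -/
def IsRationalPoint (L : Submodule k (Fin 3 → ℂ)) (p : Fin 3 → ℂ) : Prop :=
  ∃ c : ℂ, c ≠ 0 ∧ c • p ∈ L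

/-- The line orthogonal to `p` (for a null `p`, the tangent line at `p`) is rational for the
`k`-form `L`: on `L`, the functional `⟨·, p⟩` is a multiple of a functional with values in `k`.
Ratios of its values express this without choosing the factor. -/
def IsRationalTangent (L : Submodule k (Fin 3 → ℂ)) (p : Fin 3 → ℂ) : Prop :=
  ∀ x ∈ L, ∀ y ∈ L, herm x p / herm y p ∈ k

theorem IsRationalTangent.smul {p : Fin 3 → ℂ} (h : IsRationalTangent L p) {c : ℂ} (hc : c ≠ 0) :
    IsRationalTangent L (c • p) := by
  intro x hx y hy
  have hc' : conj c ≠ 0 := by simpa using hc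
  rw [herm_smul_right, herm_smul_right, mul_div_mul_left _ _ hc']
  exact h x hx y hy

theorem smul_mem_of_mem {c : ℂ} (hc : c ∈ k) {x : Fin 3 → ℂ} (hx : x ∈ L) : c • x ∈ L :=
  L.smul_mem (⟨c, hc⟩ : k) hx

theorem smul_mem_iff {c : ℂ} (hc : c ∈ k) (h0 : c ≠ 0) {x : Fin 3 → ℂ} : c • x ∈ L ↔ x ∈ L := by
  refine ⟨fun h => ?_, smul_mem_of_mem hc⟩
  simpa [smul_smul, h0] using smul_mem_of_mem (inv_mem hc) h

/-- The `k`-span of three vectors is a `k`-form. -/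
theorem detRational_span (a b c : Fin 3 → ℂ) : DetRational (Submodule.span k {a, b, c}) := by
  have key : ∀ u ∈ Submodule.span k {a, b, c}, ∀ v ∈ Submodule.span k {a, b, c},
      ∀ w ∈ Submodule.span k {a, b, c}, ∃ m ∈ k, det3 u v w = m * det3 a b c := by
    intro u hu v hv w hw
    obtain ⟨u₀, u₁, u₂, rfl⟩ := Submodule.mem_span_triple.1 hu
    obtain ⟨v₀, v₁, v₂, rfl⟩ := Submodule.mem_span_triple.1 hv
    obtain ⟨w₀, w₁, w₂, rfl⟩ := Submodule.mem_span_triple.1 hw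
    refine ⟨((Matrix.det !![u₀, u₁, u₂; v₀, v₁, v₂; w₀, w₁, w₂] : k) : ℂ), SetLike.coe_mem _, ?_⟩
    simp [det3_eq, Matrix.det_fin_three, IntermediateField.smul_def]
    ring
  intro u hu v hv w hw x hx y hy z hz
  obtain ⟨m, hm, h⟩ := key u hu v hv w hw
  obtain ⟨n, hn, h'⟩ := key x hx y hy z hz
  rw [h, h']
  by_cases h0 : det3 a b c = 0
  · simp [h0]
  · rw [mul_div_mul_right _ _ h0]
    exact div_mem hn hm

/-- The vectors of a `k`-form have coordinates in `k` with respect to a basis in the form. -/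
theorem DetRational.exists_eq (hL : DetRational L) {p q r x : Fin 3 → ℂ} (hp : p ∈ L)
    (hq : q ∈ L) (hr : r ∈ L) (hD : det3 p q r ≠ 0) (hx : x ∈ L) :
    ∃ a ∈ k, ∃ b ∈ k, ∃ c ∈ k, x = a • p + b • q + c • r := by
  refine ⟨_, hL p hp q hq r hr x hx q hq r hr, _, hL p hp q hq r hr p hp x hx r hr,
    _, hL p hp q hq r hr p hp q hq x hx, ?_⟩
  have h := congrArg ((det3 p q r)⁻¹ • ·) (det3_smul_eq p q r x)
  simpa [smul_smul, smul_add, hD, div_eq_inv_mul] using h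

/-- If four points are rational, so is the tangent line at one of them whose invariant is in
`k`. -/
theorem DetRational.isRationalTangent (hL : DetRational L) {p q r s : Fin 3 → ℂ} (hp : p ∈ L)
    (hq : q ∈ L) (hr : r ∈ L) (hs : s ∈ L) (hpp : herm p p = 0) (hpq : herm p q ≠ 0)
    (hpr : herm p r ≠ 0) (hps : herm p s ≠ 0) (hD : det3 p q r ≠ 0) (hD' : det3 p q s ≠ 0)
    (hD'' : det3 p r s ≠ 0) (hz : vertexInvariant p q r s ∈ k) : IsRationalTangent L p := by
  have hsp : herm s p ≠ 0 := fun h => hps (herm_eq_zero_comm.1 h)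
  have hz' : vertexInvariant p r q s ∈ k := by
    rw [vertexInvariant_swap_left hpp hpq hpr hps hD]
    exact sub_mem (one_mem k) hz
  -- The invariants give the ratios of the values of `⟨·, p⟩` at `q`, `r` and `s`.
  have h1 : herm r p / herm s p ∈ k := by
    have := mul_mem hz (hL p hp q hq s hs p hp q hq r hr)
    rw [vertexInvariant_eq_det3 hpp hpq] at this
    convert this using 1
    field_simp
  have h2 : herm q p / herm s p ∈ k := by
    have := mul_mem hz' (hL p hp r hr s hs p hp r hr q hq)
    rw [vertexInvariant_eq_det3 hpp hpr] at this
    have h3 : det3 p r q ≠ 0 := by rw [det3_swap_right]; exact neg_ne_zero.2 hD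
    convert this using 1
    field_simp
  have key : ∀ x ∈ L, herm x p / herm s p ∈ k := by
    intro x hx
    obtain ⟨a, ha, b, hb, c, hc, rfl⟩ := hL.exists_eq hp hq hr hD hx
    have := add_mem (mul_mem hb h2) (mul_mem hc h1)
    convert this using 1
    simp only [herm_add_left, herm_smul_left, hpp]
    ring
  intro x hx y hy
  rw [← div_div_div_cancel_right₀ hsp]
  exact div_mem (key x hx) (key y hy)

/-- A point `s` is rational if it forms generic quadruples with three rational points `p`, `q`,
`r` such that the tangent lines at `p` and `q` are rational and the invariants at `p` and `q` are
in `k`: the invariants determine the lines from `p` and `q` to `s`. -/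
theorem isRationalPoint_of_vertexInvariant {p q r s : Fin 3 → ℂ} (hp : p ∈ L)
    (hq : q ∈ L) (hr : r ∈ L) (hpp : herm p p = 0) (hqq : herm q q = 0) (hpq : herm p q ≠ 0)
    (hpr : herm p r ≠ 0) (hps : herm p s ≠ 0) (hqr : herm q r ≠ 0) (hqs : herm q s ≠ 0)
    (hD : det3 p q r ≠ 0) (hD' : det3 p q s ≠ 0) (htp : IsRationalTangent L p)
    (htq : IsRationalTangent L q) (hz : vertexInvariant p q r s ∈ k)
    (hz' : vertexInvariant q p r s ∈ k) : IsRationalPoint L s := by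
  have hqp : herm q p ≠ 0 := fun h => hpq (herm_eq_zero_comm.1 h)
  have hrp : herm r p ≠ 0 := fun h => hpr (herm_eq_zero_comm.1 h)
  have hrq : herm r q ≠ 0 := fun h => hqr (herm_eq_zero_comm.1 h)
  have hsp : herm s p ≠ 0 := fun h => hps (herm_eq_zero_comm.1 h)
  have hsq : herm s q ≠ 0 := fun h => hqs (herm_eq_zero_comm.1 h)
  have hs := det3_smul_eq p q r s
  have e1 := congrArg (herm · p) hs
  have e2 := congrArg (herm · q) hs
  simp only [herm_add_left, herm_smul_left, hpp, hqq, mul_zero, zero_add, add_zero] at e1 e2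
  rw [vertexInvariant_eq_det3 hpp hpq] at hz
  rw [vertexInvariant_eq_det3 hqq hqp, det3_swap_left p q, det3_swap_left p q] at hz'
  -- The coordinates of `s` in the basis `p`, `q`, `r`, divided by the last one.
  have h1 : det3 p s r / det3 p q s ∈ k := by
    have := mul_mem (sub_mem (inv_mem hz) (one_mem k)) (htp r hr q hq)
    convert this using 1
    field_simp
    linear_combination -e1
  have h2 : det3 s q r / det3 p q s ∈ k := by
    have := mul_mem (sub_mem (inv_mem hz') (one_mem k)) (htq r hr p hp)
    convert this using 1
    field_simp
    linear_combination -e2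
  refine ⟨det3 p q r / det3 p q s, div_ne_zero hD hD', ?_⟩
  have h3 := congrArg ((det3 p q s)⁻¹ • ·) hs
  simp only [smul_add, smul_smul, inv_mul_cancel₀ hD', one_smul] at h3
  rw [div_eq_inv_mul, h3, ← div_eq_inv_mul, ← div_eq_inv_mul]
  exact add_mem (add_mem (smul_mem_of_mem h2 hp) (smul_mem_of_mem h1 hq)) hr

/-- `A` preserves the `k`-form `L` up to a scalar. -/
def PreservesUpToScalar (L : Submodule k (Fin 3 → ℂ)) (A : Matrix (Fin 3) (Fin 3) ℂ) : Prop :=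
  ∃ m : ℂ, m ≠ 0 ∧ ∀ x ∈ L, m • (A *ᵥ x) ∈ L

/-- An isometry that takes three rational points with rational tangent lines to three such points
preserves the `k`-form up to a scalar. -/
theorem DetRational.preservesUpToScalar (hL : DetRational L) {A : Matrix (Fin 3) (Fin 3) ℂ}
    (hA : ∀ x y, herm (A *ᵥ x) (A *ᵥ y) = herm x y) {p q r p' q' r' : Fin 3 → ℂ}
    (hp : p ∈ L) (hq : q ∈ L) (hr : r ∈ L) (hp' : p' ∈ L) (hq' : q' ∈ L) (hr' : r' ∈ L)
    (hD : det3 p q r ≠ 0) (hpq : herm p q ≠ 0) (hpr : herm p r ≠ 0) (hqr : herm q r ≠ 0)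
    (htp : IsRationalTangent L p) (htq : IsRationalTangent L q)
    (htp' : IsRationalTangent L p') (htq' : IsRationalTangent L q')
    (hAp : ∃ a : ℂ, A *ᵥ p = a • p') (hAq : ∃ a : ℂ, A *ᵥ q = a • q')
    (hAr : ∃ a : ℂ, A *ᵥ r = a • r') : PreservesUpToScalar L A := by
  obtain ⟨a, ha⟩ := hAp
  obtain ⟨b, hb⟩ := hAq
  obtain ⟨c, hc⟩ := hAr
  have hqp : herm q p ≠ 0 := fun h => hpq (herm_eq_zero_comm.1 h)
  have hrp : herm r p ≠ 0 := fun h => hpr (herm_eq_zero_comm.1 h)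
  have hrq : herm r q ≠ 0 := fun h => hqr (herm_eq_zero_comm.1 h)
  have e1 := hA q p
  have e2 := hA r p
  have e3 := hA p q
  have e4 := hA r q
  simp only [ha, hb, hc, herm_smul_smul] at e1 e2 e3 e4
  have hc0 : c ≠ 0 := by rintro rfl; simp at e2; exact hrp e2.symm
  have n1 : conj a ≠ 0 := fun h => hqp (by rw [← e1, h]; ring)
  have n2 : conj b ≠ 0 := fun h => hpq (by rw [← e3, h]; ring)
  have n3 : herm q' p' ≠ 0 := fun h => hqp (by rw [← e1, h]; ring)
  have n4 : herm r' p' ≠ 0 := fun h => hrp (by rw [← e2, h]; ring)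
  have n5 : herm p' q' ≠ 0 := fun h => hpq (by rw [← e3, h]; ring)
  have n6 : herm r' q' ≠ 0 := fun h => hrq (by rw [← e4, h]; ring)
  -- As `A` is an isometry, the products with `p` determine `b / c` and those with `q` give `a / c`.
  have hbc : b / c ∈ k := by
    have := mul_mem (htp q hq r hr) (htp' r' hr' q' hq')
    rw [← e1, ← e2] at this
    convert this using 1
    field_simp
  have hac : a / c ∈ k := by
    have := mul_mem (htq p hp r hr) (htq' r' hr' p' hp')
    rw [← e3, ← e4] at this
    convert this using 1
    field_simp
  refine ⟨c⁻¹, inv_ne_zero hc0, fun x hx => ?_⟩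
  obtain ⟨x₀, h₀, x₁, h₁, x₂, h₂, rfl⟩ := hL.exists_eq hp hq hr hD hx
  have : c⁻¹ • (A *ᵥ (x₀ • p + x₁ • q + x₂ • r)) =
      (x₀ * (a / c)) • p' + (x₁ * (b / c)) • q' + x₂ • r' := by
    simp only [Matrix.mulVec_add, Matrix.mulVec_smul, ha, hb, hc, smul_add, smul_smul]
    congr 2
    · congr 1; ring
    · congr 1; ring
    · field_simp
  rw [this]
  exact add_mem (add_mem (smul_mem_of_mem (mul_mem h₀ hac) hp')
    (smul_mem_of_mem (mul_mem h₁ hbc) hq')) (smul_mem_of_mem h₂ hr')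

/-- A matrix that preserves a `k`-form has its trace in `k`. -/
theorem DetRational.trace_mem (hL : DetRational L) {A : Matrix (Fin 3) (Fin 3) ℂ}
    {p q r : Fin 3 → ℂ} (hp : p ∈ L) (hq : q ∈ L) (hr : r ∈ L) (hD : det3 p q r ≠ 0)
    (hA : ∀ x ∈ L, A *ᵥ x ∈ L) : A.trace ∈ k := by
  have h := hL p hp q hq r hr
  have := add_mem (add_mem (h _ (hA p hp) q hq r hr) (h p hp _ (hA q hq) r hr))
    (h p hp q hq _ (hA r hr))
  rw [← add_div, ← add_div, ← trace_mul_det3, mul_div_cancel_right₀ _ hD] at this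
  exact this

/-- The cube of a matrix of determinant `1` that preserves a `k`-form up to a scalar `m` preserves
the form: the determinant shows that `m ^ 3` is in `k`. -/
theorem DetRational.pow_three_mulVec_mem (hL : DetRational L) {A : Matrix (Fin 3) (Fin 3) ℂ}
    (hA1 : A.det = 1) {p q r : Fin 3 → ℂ} (hp : p ∈ L) (hq : q ∈ L) (hr : r ∈ L)
    (hD : det3 p q r ≠ 0) (hA : PreservesUpToScalar L A) {x : Fin 3 → ℂ} (hx : x ∈ L) :
    A ^ 3 *ᵥ x ∈ L := by
  obtain ⟨m, hm, h⟩ := hA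
  have h1 : m ^ 3 ∈ k := by
    have := hL p hp q hq r hr _ (h p hp) _ (h q hq) _ (h r hr)
    rw [det3_smul_smul_smul, det3_mulVec, hA1, one_mul, mul_div_cancel_right₀ _ hD] at this
    convert this using 1
    ring
  rw [← smul_mem_iff h1 (pow_ne_zero 3 hm)]
  have := h _ (h _ (h x hx))
  simp only [Matrix.mulVec_smul, smul_smul, Matrix.mulVec_mulVec] at this
  convert this using 2
  · ring
  · rw [pow_three]

theorem PreservesUpToScalar.mul {A B : Matrix (Fin 3) (Fin 3) ℂ} (hA : PreservesUpToScalar L A)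
    (hB : PreservesUpToScalar L B) : PreservesUpToScalar L (A * B) := by
  obtain ⟨m, hm, h⟩ := hA
  obtain ⟨n, hn, h'⟩ := hB
  refine ⟨m * n, mul_ne_zero hm hn, fun x hx => ?_⟩
  have := h _ (h' x hx)
  rwa [Matrix.mulVec_smul, Matrix.mulVec_mulVec, smul_smul] at this

theorem DetRational.preservesUpToScalar_of_mul_eq_one (hL : DetRational L)
    {A B : Matrix (Fin 3) (Fin 3) ℂ} (hAB : B * A = 1) {p q r : Fin 3 → ℂ} (hp : p ∈ L)
    (hq : q ∈ L) (hr : r ∈ L) (hD : det3 p q r ≠ 0) (hA : PreservesUpToScalar L A) :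
    PreservesUpToScalar L B := by
  obtain ⟨m, hm, h⟩ := hA
  refine ⟨m⁻¹, inv_ne_zero hm, fun x hx => ?_⟩
  have hdet : A.det ≠ 0 := fun h0 => by simpa [h0] using congrArg Matrix.det hAB
  have hD' : det3 (m • (A *ᵥ p)) (m • (A *ᵥ q)) (m • (A *ᵥ r)) ≠ 0 := by
    rw [det3_smul_smul_smul, det3_mulVec]
    exact mul_ne_zero (by simp [hm]) (mul_ne_zero hdet hD)
  obtain ⟨a, ha, b, hb, c, hc, rfl⟩ := hL.exists_eq (h p hp) (h q hq) (h r hr) hD' hx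
  have : m⁻¹ • (B *ᵥ (a • m • (A *ᵥ p) + b • m • (A *ᵥ q) + c • m • (A *ᵥ r))) =
      a • p + b • q + c • r := by
    simp only [Matrix.mulVec_add, Matrix.mulVec_smul, Matrix.mulVec_mulVec, hAB,
      Matrix.one_mulVec, smul_add, smul_smul]
    congr 2
    · congr 1; field_simp
    · congr 1; field_simp
    · field_simp
  rw [this]
  exact add_mem (add_mem (smul_mem_of_mem ha hp) (smul_mem_of_mem hb hq)) (smul_mem_of_mem hc hr)

end Rational

/-! ### The action of `SU(2,1)` -/

theorem SU21.herm_mulVec (g : SU21) (x y : Fin 3 → ℂ) :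
    herm (g.1.1 *ᵥ x) (g.1.1 *ᵥ y) = herm x y := by
  have h : g.1.1ᴴ * siegelJ * g.1.1 = siegelJ := g.2
  generalize g.1.1 = A at h
  rw [herm_eq, herm_eq, Matrix.star_mulVec, ← Matrix.dotProduct_mulVec, Matrix.mulVec_mulVec,
    Matrix.mulVec_mulVec, h]

theorem SU21.inv_mul_coe (g : SU21) : (g⁻¹).1.1 * g.1.1 = 1 :=
  congrArg (fun A : SU21 => A.1.1) (inv_mul_cancel g)

theorem toPU21_surjective : Function.Surjective toPU21 :=
  MonoidHom.rangeRestrict_surjective _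

theorem toPU21_smul_eq_iff (g : SU21) (p q : ℙ ℂ (Fin 3 → ℂ)) :
    toPU21 g • p = q ↔ ∃ a : ℂ, g.1.1 *ᵥ p.rep = a • q.rep := by
  have h0 : g.1.1 *ᵥ p.rep ≠ 0 := fun h => p.rep_nonzero <| by
    rw [← Matrix.one_mulVec p.rep, ← SU21.inv_mul_coe g, ← Matrix.mulVec_mulVec, h,
      Matrix.mulVec_zero]
  have h1 : toPU21 g • p = Projectivization.mk ℂ (g.1.1 *ᵥ p.rep) h0 := by
    conv_lhs => rw [← p.mk_rep]
    rfl
  conv_lhs => rw [h1, ← q.mk_rep, Projectivization.mk_eq_mk_iff']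
  simp only [eq_comm]

/-! ### Rationality of realized tetrahedra -/

theorem exists_three_ne (i : Fin 4) : ∃ a b c : Fin 4, a ≠ i ∧ b ≠ i ∧ c ≠ i ∧
    a ≠ b ∧ b ≠ c ∧ a ≠ c := by
  decide +revert

theorem eq_or_eq_or_eq_of_ne {a e f g x : Fin 4} (hae : a ≠ e) (haf : a ≠ f) (hag : a ≠ g)
    (hef : e ≠ f) (heg : e ≠ g) (hfg : f ≠ g) (hax : a ≠ x) : x = e ∨ x = f ∨ x = g := by
  decide +revert

section Rational

variable {k : IntermediateField ℚ ℂ} {L : Submodule k (Fin 3 → ℂ)}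

/-- The invariants of a generic quadruple at all vertices and for all orderings of the remaining
vertices lie in the field of the four chosen ones. -/
theorem GenericPosition.vertexInvariant_mem {x : Fin 4 → HBoundary} (hx : GenericPosition x)
    (h : ∀ j, tetInvariants x j ∈ k) {a b c d : Fin 4} (hab : a ≠ b) (hac : a ≠ c)
    (had : a ≠ d) (hbc : b ≠ c) (hbd : b ≠ d) (hcd : c ≠ d) :
    vertexInvariant (x a).1.rep (x b).1.rep (x c).1.rep (x d).1.rep ∈ k := by
  -- Membership for one ordering of the last three vertices gives it for all of them.
  have swap : ∀ {b c d : Fin 4}, a ≠ b → a ≠ c → a ≠ d → b ≠ c → b ≠ d → c ≠ d →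
      vertexInvariant (x a).1.rep (x b).1.rep (x c).1.rep (x d).1.rep ∈ k →
      vertexInvariant (x a).1.rep (x b).1.rep (x d).1.rep (x c).1.rep ∈ k ∧
      vertexInvariant (x a).1.rep (x c).1.rep (x b).1.rep (x d).1.rep ∈ k := by
    intro b c d hab hac had hbc hbd hcd hz
    have hb := hx.herm_ne_zero hab
    have ha := (x a).herm_self
    rw [vertexInvariant_swap_right ha hb, vertexInvariant_swap_left ha hb (hx.herm_ne_zero hac)
      (hx.herm_ne_zero had) (hx.det3_ne_zero hab hbc hac)]
    exact ⟨inv_mem hz, sub_mem (one_mem k) hz⟩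
  have perms : ∀ {e f g : Fin 4}, a ≠ e → a ≠ f → a ≠ g → e ≠ f → e ≠ g → f ≠ g →
      vertexInvariant (x a).1.rep (x e).1.rep (x f).1.rep (x g).1.rep ∈ k →
      vertexInvariant (x a).1.rep (x b).1.rep (x c).1.rep (x d).1.rep ∈ k := by
    intro e f g h1 h2 h3 h4 h5 h6 hz
    have s1 := swap h1 h2 h3 h4 h5 h6 hz
    have s2 := swap h1 h3 h2 h5 h4 h6.symm s1.1
    have s3 := swap h2 h1 h3 h4.symm h6 h5 s1.2
    have s4 := swap h3 h1 h2 h5.symm h6.symm h4 s2.2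
    have mem := fun x => eq_or_eq_or_eq_of_ne h1 h2 h3 h4 h5 h6 (x := x)
    rcases mem b hab with rfl | rfl | rfl <;> rcases mem c hac with rfl | rfl | rfl <;>
      rcases mem d had with rfl | rfl | rfl <;>
      first | exact absurd rfl hbc | exact absurd rfl hbd | exact absurd rfl hcd | skip
    exacts [hz, s1.1, s1.2, s3.1, s2.2, s4.1]
  have h0 := h 0
  have h1 := h 1
  have h2 := h 2
  have h3 := h 3
  simp only [tetInvariants, Matrix.cons_val] at h0 h1 h2 h3
  fin_cases a
  · exact perms (by decide) (by decide) (by decide) (by decide) (by decide) (by decide) h0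
  · exact perms (by decide) (by decide) (by decide) (by decide) (by decide) (by decide) h1
  · exact perms (by decide) (by decide) (by decide) (by decide) (by decide) (by decide) h2
  · exact perms (by decide) (by decide) (by decide) (by decide) (by decide) (by decide) h3

/-- If the vertices of a generic quadruple with invariants in `k` are rational, so are the
tangent lines. -/
theorem GenericPosition.isRationalTangent {x : Fin 4 → HBoundary} (hx : GenericPosition x)
    (h : ∀ j, tetInvariants x j ∈ k) (hL : DetRational L)
    (hr : ∀ v, IsRationalPoint L (x v).1.rep) (v : Fin 4) :
    IsRationalTangent L (x v).1.rep := by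
  obtain ⟨a, b, c, ha, hb, hc, hab, hbc, hac⟩ := exists_three_ne v
  choose s hs0 hs using hr
  have hz := hx.vertexInvariant_mem h ha.symm hb.symm hc.symm hab hac hbc
  rw [← vertexInvariant_smul (hs0 v) (hs0 a) (hs0 b) (hs0 c) (x v).herm_self
    (hx.herm_ne_zero ha.symm)] at hz
  have hdet : ∀ {i j l}, i ≠ j → j ≠ l → i ≠ l →
      det3 (s i • (x i).1.rep) (s j • (x j).1.rep) (s l • (x l).1.rep) ≠ 0 := by
    intro i j l hij hjl hil
    rw [det3_smul_smul_smul]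
    exact mul_ne_zero (mul_ne_zero (mul_ne_zero (hs0 i) (hs0 j)) (hs0 l))
      (hx.det3_ne_zero hij hjl hil)
  have hherm : ∀ {i j}, i ≠ j → herm (s i • (x i).1.rep) (s j • (x j).1.rep) ≠ 0 := by
    intro i j hij
    rw [herm_smul_smul]
    exact mul_ne_zero (mul_ne_zero (hs0 i) (by simpa using hs0 j)) (hx.herm_ne_zero hij)
  have key := hL.isRationalTangent (hs v) (hs a) (hs b) (hs c)
    (by rw [herm_smul_smul, (x v).herm_self, mul_zero]) (hherm ha.symm) (hherm hb.symm)
    (hherm hc.symm) (hdet ha.symm hab hb.symm) (hdet ha.symm hac hc.symm)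
    (hdet hb.symm hbc hc.symm) hz
  simpa [smul_smul, hs0 v] using key.smul (inv_ne_zero (hs0 v))

/-- If three vertices of a generic quadruple with invariants in `k` are rational with rational
tangent lines, then the fourth vertex is rational. -/
theorem GenericPosition.isRationalPoint {x : Fin 4 → HBoundary} (hx : GenericPosition x)
    (h : ∀ j, tetInvariants x j ∈ k) {v : Fin 4}
    (hr : ∀ w, w ≠ v → IsRationalPoint L (x w).1.rep)
    (ht : ∀ w, w ≠ v → IsRationalTangent L (x w).1.rep) : IsRationalPoint L (x v).1.rep := by
  obtain ⟨a, b, c, ha, hb, hc, hab, hbc, hac⟩ := exists_three_ne v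
  obtain ⟨s, hs0, hs⟩ := hr a ha
  obtain ⟨t, ht0, ht'⟩ := hr b hb
  obtain ⟨u, hu0, hu⟩ := hr c hc
  have hz := hx.vertexInvariant_mem h hab hac ha hbc hb hc
  have hz' := hx.vertexInvariant_mem h hab.symm hbc hb hac ha hc
  rw [← vertexInvariant_smul hs0 ht0 hu0 one_ne_zero (x a).herm_self
    (hx.herm_ne_zero hab)] at hz
  rw [← vertexInvariant_smul ht0 hs0 hu0 one_ne_zero (x b).herm_self
    (hx.herm_ne_zero hab.symm)] at hz'
  have hherm : ∀ {i j} {s t : ℂ}, i ≠ j → s ≠ 0 → t ≠ 0 →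
      herm (s • (x i).1.rep) (t • (x j).1.rep) ≠ 0 := by
    intro i j s t hij hs ht
    rw [herm_smul_smul]
    exact mul_ne_zero (mul_ne_zero hs (by simpa using ht)) (hx.herm_ne_zero hij)
  have hdet : ∀ {i j l} {s t u : ℂ}, i ≠ j → j ≠ l → i ≠ l → s ≠ 0 → t ≠ 0 → u ≠ 0 →
      det3 (s • (x i).1.rep) (t • (x j).1.rep) (u • (x l).1.rep) ≠ 0 := by
    intro i j l s t u hij hjl hil hs ht hu
    rw [det3_smul_smul_smul]
    exact mul_ne_zero (mul_ne_zero (mul_ne_zero hs ht) hu) (hx.det3_ne_zero hij hjl hil)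
  have key := isRationalPoint_of_vertexInvariant hs ht' hu
    (by rw [herm_smul_smul, (x a).herm_self, mul_zero])
    (by rw [herm_smul_smul, (x b).herm_self, mul_zero])
    (hherm hab hs0 ht0) (hherm hac hs0 hu0) (hherm ha hs0 one_ne_zero) (hherm hbc ht0 hu0)
    (hherm hb ht0 one_ne_zero) (hdet hab hbc hac hs0 ht0 hu0)
    (hdet hab hb ha hs0 ht0 one_ne_zero) ((ht a ha).smul hs0) ((ht b hb).smul ht0) hz hz'
  simpa using key

/-- Any generic quadruple has a `k`-form for which its points are rational. -/
theorem GenericPosition.exists_detRational (k : IntermediateField ℚ ℂ) {x : Fin 4 → HBoundary}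
    (hx : GenericPosition x) : ∃ L : Submodule k (Fin 3 → ℂ), DetRational L ∧
      ∀ v, IsRationalPoint L (x v).1.rep := by
  have d1 := hx.det3_ne_zero (i := 3) (j := 1) (k := 2) (by decide) (by decide) (by decide)
  have d2 := hx.det3_ne_zero (i := 0) (j := 3) (k := 2) (by decide) (by decide) (by decide)
  have d3 := hx.det3_ne_zero (i := 0) (j := 1) (k := 3) (by decide) (by decide) (by decide)
  have d := hx.det3_ne_zero (i := 0) (j := 1) (k := 2) (by decide) (by decide) (by decide)
  refine ⟨_, detRational_span (det3 (x 3).1.rep (x 1).1.rep (x 2).1.rep • (x 0).1.rep)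
    (det3 (x 0).1.rep (x 3).1.rep (x 2).1.rep • (x 1).1.rep)
    (det3 (x 0).1.rep (x 1).1.rep (x 3).1.rep • (x 2).1.rep), fun v => ?_⟩
  fin_cases v
  · exact ⟨_, d1, Submodule.subset_span (by simp)⟩
  · exact ⟨_, d2, Submodule.subset_span (by simp)⟩
  · exact ⟨_, d3, Submodule.subset_span (by simp)⟩
  · refine ⟨_, d, ?_⟩
    change det3 (x 0).1.rep (x 1).1.rep (x 2).1.rep • (x 3).1.rep ∈ _
    rw [det3_smul_eq (x 0).1.rep (x 1).1.rep (x 2).1.rep (x 3).1.rep]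
    exact add_mem (add_mem (Submodule.subset_span (by simp)) (Submodule.subset_span (by simp)))
      (Submodule.subset_span (by simp))

/-- An element of `SU(2,1)` that takes three vertices of a rational generic quadruple to rational
points with rational tangent lines preserves the `k`-form up to a scalar. -/
theorem GenericPosition.preservesUpToScalar {x : Fin 4 → HBoundary} (hx : GenericPosition x)
    (hL : DetRational L) (hr : ∀ v, IsRationalPoint L (x v).1.rep)
    (ht : ∀ v, IsRationalTangent L (x v).1.rep) (g : SU21) (i : Fin 4)
    (hg : ∀ v, v ≠ i → ∃ y : HBoundary, toPU21 g • (x v).1 = y.1 ∧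
      IsRationalPoint L y.1.rep ∧ IsRationalTangent L y.1.rep) :
    PreservesUpToScalar L g.1.1 := by
  obtain ⟨a, b, c, ha, hb, hc, hab, hbc, hac⟩ := exists_three_ne i
  choose s hs0 hs using hr
  have image : ∀ v, v ≠ i → ∃ y' ∈ L, IsRationalTangent L y' ∧
      ∃ m : ℂ, g.1.1 *ᵥ (s v • (x v).1.rep) = m • y' := by
    intro v hv
    obtain ⟨y, hy, ⟨t, ht0, hyt⟩, hy'⟩ := hg v hv
    obtain ⟨m, hm⟩ := (toPU21_smul_eq_iff _ _ _).1 hy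
    refine ⟨_, hyt, hy'.smul ht0, s v * m * t⁻¹, ?_⟩
    rw [Matrix.mulVec_smul, hm, smul_smul, smul_smul, inv_mul_cancel_right₀ ht0]
  obtain ⟨a', ha', hta, ma⟩ := image a ha
  obtain ⟨b', hb', htb, mb⟩ := image b hb
  obtain ⟨c', hc', -, mc⟩ := image c hc
  have hherm : ∀ {i j}, i ≠ j → herm (s i • (x i).1.rep) (s j • (x j).1.rep) ≠ 0 := by
    intro i j hij
    rw [herm_smul_smul]
    exact mul_ne_zero (mul_ne_zero (hs0 i) (by simpa using hs0 j)) (hx.herm_ne_zero hij)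
  refine hL.preservesUpToScalar (SU21.herm_mulVec g) (hs a) (hs b) (hs c) ha' hb' hc' ?_ (hherm hab)
    (hherm hac) (hherm hbc) ((ht a).smul (hs0 a)) ((ht b).smul (hs0 b)) hta htb ma mb mc
  rw [det3_smul_smul_smul]
  exact mul_ne_zero (mul_ne_zero (mul_ne_zero (hs0 a) (hs0 b)) (hs0 c))
    (hx.det3_ne_zero hab hbc hac)

end Rational

/-- All vertices of a realized ideal triangulation, and the tangent lines there, are rational for
a common form of `ℂ³` over the field of the invariants. -/
theorem IdealTriangulation.Realization.exists_rational {τ : Type*} {T : IdealTriangulation τ}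
    (R : T.Realization) (t₀ : τ) : ∃ L : Submodule R.invariantField (Fin 3 → ℂ),
      DetRational L ∧ ∀ t v, IsRationalPoint L (R.vertex t v).1.rep ∧
        IsRationalTangent L (R.vertex t v).1.rep := by
  have hinv : ∀ t j, tetInvariants (R.vertex t) j ∈ R.invariantField :=
    fun t j => IntermediateField.subset_adjoin ℚ _ ⟨t, j, rfl⟩
  obtain ⟨L, hL, hr⟩ := (R.generic t₀).exists_detRational R.invariantField
  refine ⟨L, hL, fun t => ?_⟩
  suffices h : ∀ v, IsRationalPoint L (R.vertex t v).1.rep from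
    fun v => ⟨h v, (R.generic t).isRationalTangent (hinv t) hL h v⟩
  induction R.developed t₀ t with
  | refl => exact hr
  | @tail a b _ hab ih =>
    obtain ⟨i, rfl, hi⟩ := hab
    have htan := (R.generic a).isRationalTangent (hinv a) hL ih
    -- The vertices of the new tetrahedron other than `perm a i i` are vertices of `a`.
    have hvert : ∀ w, w ≠ T.perm a i i → ∃ v, R.vertex (T.nbr a i) w = R.vertex a v := by
      intro w hw
      obtain ⟨v, rfl⟩ := (T.perm a i).surjective w
      refine ⟨v, Subtype.ext ?_⟩
      rw [← R.pairing_smul a i v (fun h => hw (by rw [h])), hi, one_smul]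
    intro w
    by_cases hw : w = T.perm a i i
    · subst hw
      refine (R.generic _).isRationalPoint (hinv _) (fun w hw => ?_) (fun w hw => ?_)
      · obtain ⟨v, hv⟩ := hvert w hw
        rw [hv]
        exact ih v
      · obtain ⟨v, hv⟩ := hvert w hw
        rw [hv]
        exact htan v
    · obtain ⟨v, hv⟩ := hvert w hw
      rw [hv]
      exact ih v

/-- The lifts of the elements of the group generated by the face-pairings preserve a form of `ℂ³`
over the field of the invariants up to scalars, hence their cubes preserve the form. -/
theorem IdealTriangulation.Realization.cubeTraceField_le {τ : Type*} {T : IdealTriangulation τ}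
    (R : T.Realization) (t₀ : τ) :
    cubeTraceField (Subgroup.closure {g | ∃ t i, g = R.pairing t i}) ≤ R.invariantField := by
  obtain ⟨L, hL, hrat⟩ := R.exists_rational t₀
  have hgen := R.generic t₀
  choose s hs0 hs using fun v => (hrat t₀ v).1
  have hD : det3 (s 0 • (R.vertex t₀ 0).1.rep) (s 1 • (R.vertex t₀ 1).1.rep)
      (s 2 • (R.vertex t₀ 2).1.rep) ≠ 0 := by
    rw [det3_smul_smul_smul]
    exact mul_ne_zero (mul_ne_zero (mul_ne_zero (hs0 0) (hs0 1)) (hs0 2))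
      (hgen.det3_ne_zero (by decide) (by decide) (by decide))
  let S : Subgroup SU21 :=
    { carrier := {g | PreservesUpToScalar L g.1.1}
      one_mem' := ⟨1, one_ne_zero, fun x hx => by simpa using hx⟩
      mul_mem' := fun hA hB => hA.mul hB
      inv_mem' := fun {g} hg =>
        hL.preservesUpToScalar_of_mul_eq_one (SU21.inv_mul_coe g) (hs 0) (hs 1) (hs 2) hD hg }
  have hker : toPU21.ker ≤ S := by
    intro g hg
    refine hgen.preservesUpToScalar hL (fun v => (hrat t₀ v).1) (fun v => (hrat t₀ v).2) g 0
      fun v _ => ⟨R.vertex t₀ v, ?_, hrat t₀ v⟩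
    rw [MonoidHom.mem_ker.1 hg, one_smul]
  have hlifts : lifts (Subgroup.closure {g | ∃ t i, g = R.pairing t i}) ≤ S := by
    rw [← Subgroup.comap_map_eq_self hker]
    refine Subgroup.comap_mono ((Subgroup.closure_le _).2 ?_)
    rintro _ ⟨t, i, rfl⟩
    obtain ⟨g, hg⟩ := toPU21_surjective (R.pairing t i)
    refine ⟨g, (R.generic t).preservesUpToScalar hL (fun v => (hrat t v).1)
      (fun v => (hrat t v).2) g i fun v hv =>
        ⟨R.vertex (T.nbr t i) (T.perm t i v), ?_, hrat _ _⟩, hg⟩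
    rw [hg]
    exact R.pairing_smul t i v hv
  let S' : Submonoid SU21 :=
    { carrier := {g | ∀ x ∈ L, g.1.1 *ᵥ x ∈ L}
      one_mem' := fun x hx => by simpa using hx
      mul_mem' := fun {g h} hg hh x hx => by
        have := hg _ (hh x hx)
        rwa [Matrix.mulVec_mulVec] at this }
  -- The set of cubes is closed under inverses, so the subgroup it generates is its monoid closure.
  have hcube : ∀ g ∈ cubeSubgroup (lifts (Subgroup.closure {g | ∃ t i, g = R.pairing t i})),
      g ∈ S' := by
    have hpow : ∀ g ∈ S, g ^ 3 ∈ S' := fun g hg x hx =>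
      hL.pow_three_mulVec_mem g.1.2 (hs 0) (hs 1) (hs 2) hD hg hx
    intro g hg
    induction hg using Subgroup.closure_induction'' with
    | one => exact S'.one_mem
    | mem g hg =>
      obtain ⟨h, hh, rfl⟩ := hg
      exact hpow h (hlifts hh)
    | inv_mem g hg =>
      obtain ⟨h, hh, rfl⟩ := hg
      rw [← inv_pow]
      exact hpow _ (S.inv_mem (hlifts hh))
    | mul g h _ _ hg hh => exact S'.mul_mem hg hh
  refine IntermediateField.adjoin_le_iff.2 ?_
  rintro _ ⟨g, hg, rfl⟩
  exact hL.trace_mem (hs 0) (hs 1) (hs 2) hD (hcube g hg)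

/-! ### Square-zero matrices commuting with a parabolic element -/

/-- The adjoint of a matrix for the Hermitian form. -/
def hermAdjoint (A : Matrix (Fin 3) (Fin 3) ℂ) : Matrix (Fin 3) (Fin 3) ℂ :=
  siegelJ * Aᴴ * siegelJ

theorem siegelJ_mul_self : siegelJ * siegelJ = 1 := by
  ext i j
  fin_cases i <;> fin_cases j <;> simp [siegelJ, Matrix.mul_apply, Fin.sum_univ_three]

theorem siegelJ_conjTranspose : siegelJᴴ = siegelJ := by
  ext i j
  fin_cases i <;> fin_cases j <;> simp [siegelJ]

theorem hermAdjoint_mul (A B : Matrix (Fin 3) (Fin 3) ℂ) :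
    hermAdjoint (A * B) = hermAdjoint B * hermAdjoint A := by
  simp only [hermAdjoint, Matrix.conjTranspose_mul]
  calc siegelJ * (Bᴴ * Aᴴ) * siegelJ = siegelJ * Bᴴ * 1 * Aᴴ * siegelJ := by
        simp only [Matrix.mul_assoc, Matrix.one_mul]
    _ = _ := by rw [← siegelJ_mul_self]; simp only [Matrix.mul_assoc]

theorem hermAdjoint_hermAdjoint (A : Matrix (Fin 3) (Fin 3) ℂ) :
    hermAdjoint (hermAdjoint A) = A := by
  simp only [hermAdjoint, Matrix.conjTranspose_mul, Matrix.conjTranspose_conjTranspose,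
    siegelJ_conjTranspose]
  calc siegelJ * (siegelJ * (A * siegelJ)) * siegelJ
      = (siegelJ * siegelJ) * A * (siegelJ * siegelJ) := by simp only [Matrix.mul_assoc]
    _ = A := by rw [siegelJ_mul_self, Matrix.one_mul, Matrix.mul_one]

theorem hermAdjoint_zero : hermAdjoint 0 = 0 := by
  simp [hermAdjoint]

theorem herm_mulVec_left (A : Matrix (Fin 3) (Fin 3) ℂ) (x y : Fin 3 → ℂ) :
    herm (A *ᵥ x) y = herm x (hermAdjoint A *ᵥ y) := by
  simp only [herm_eq, hermAdjoint, Matrix.star_mulVec, Matrix.conjTranspose_mul,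
    Matrix.conjTranspose_conjTranspose, siegelJ_conjTranspose]
  rw [← Matrix.dotProduct_mulVec, Matrix.mulVec_mulVec, Matrix.mulVec_mulVec,
    show siegelJ * (A * siegelJ) * siegelJ = siegelJ * A * (siegelJ * siegelJ) by
      simp only [Matrix.mul_assoc], siegelJ_mul_self, Matrix.mul_one]

theorem SU21.hermAdjoint_mul_self (g : SU21) : hermAdjoint g.1.1 * g.1.1 = 1 := by
  have h : g.1.1ᴴ * siegelJ * g.1.1 = siegelJ := g.2
  rw [hermAdjoint, Matrix.mul_assoc, Matrix.mul_assoc, ← Matrix.mul_assoc g.1.1ᴴ]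
  exact (congrArg (siegelJ * ·) h).trans siegelJ_mul_self

/-- The matrix of the rank one map `x ↦ ⟨x, v⟩ v`. -/
def hermDyad (v : Fin 3 → ℂ) : Matrix (Fin 3) (Fin 3) ℂ :=
  Matrix.vecMulVec v ![conj (v 2), conj (v 1), conj (v 0)]

theorem hermDyad_mulVec (v x : Fin 3 → ℂ) : hermDyad v *ᵥ x = herm x v • v := by
  ext i
  simp [hermDyad, herm, Matrix.mulVec, Matrix.vecMulVec_apply, dotProduct, Fin.sum_univ_three]
  ring

theorem trace_hermDyad_mul (p q : Fin 3 → ℂ) :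
    (hermDyad p * hermDyad q).trace = herm p q * herm q p := by
  simp [hermDyad, herm, Matrix.trace, Matrix.mul_apply, Fin.sum_univ_three]
  ring

theorem trace_hermDyad_mul_mul (p q r : Fin 3 → ℂ) :
    (hermDyad p * hermDyad q * hermDyad r).trace = herm p r * herm r q * herm q p := by
  simp [hermDyad, herm, Matrix.trace, Matrix.mul_apply, Fin.sum_univ_three]
  ring

/-- `v` represents the only fixed boundary point of `g`. -/
structure IsUniqueNullEigenvector (g : SU21) (v : Fin 3 → ℂ) : Prop where
  ne_zero : v ≠ 0
  null : herm v v = 0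
  eigen : ∃ a : ℂ, g.1.1 *ᵥ v = a • v
  unique : ∀ n : Fin 3 → ℂ, n ≠ 0 → herm n n = 0 → (∃ b : ℂ, g.1.1 *ᵥ n = b • n) →
    ∃ c : ℂ, n = c • v

theorem IsParabolic.isUniqueNullEigenvector {g : SU21} {p : HBoundary}
    (h : IsParabolic (toPU21 g)) (hp : toPU21 g • p.1 = p.1) :
    IsUniqueNullEigenvector g p.1.rep := by
  refine ⟨p.rep_ne_zero, p.herm_self, (toPU21_smul_eq_iff _ _ _).1 hp, fun n hn hnn hg => ?_⟩
  obtain ⟨m, hm⟩ := Projectivization.exists_smul_eq_mk_rep ℂ n hn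
  have hm' : (m : ℂ) • n = (Projectivization.mk ℂ n hn).rep := hm
  let q : HBoundary := ⟨Projectivization.mk ℂ n hn, by
    rw [← hm', herm_smul_smul, hnn, mul_zero]⟩
  have hq : toPU21 g • q.1 = q.1 := by
    obtain ⟨b, hb⟩ := hg
    refine (toPU21_smul_eq_iff _ _ _).2 ⟨b, ?_⟩
    rw [← hm', Matrix.mulVec_smul, hb, smul_comm]
  have hqp : q = p := h.unique hq hp
  refine ⟨(m : ℂ)⁻¹, ?_⟩
  rw [← hqp, ← hm', smul_smul, inv_mul_cancel₀ m.ne_zero, one_smul]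

/-- A diagonalizable element of `SU(2,1)` that fixes a boundary point fixes another one. -/
theorem IsUniqueNullEigenvector.not_isSemisimple {g : SU21} {v : Fin 3 → ℂ}
    (hv : IsUniqueNullEigenvector g v) : ¬ Module.End.IsSemisimple (Matrix.toLin' g.1.1) := by
  intro hss
  obtain ⟨a, ha⟩ := hv.eigen
  obtain ⟨b, w, hw, hwv⟩ : ∃ b : ℂ, ∃ w, g.1.1 *ᵥ w = b • w ∧ herm w v ≠ 0 := by
    by_contra! h
    refine hv.ne_zero (eq_zero_of_herm_eq_zero fun x => herm_eq_zero_comm.1 ?_)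
    have hx : x ∈ ⨆ μ : ℂ, Module.End.eigenspace (Matrix.toLin' g.1.1) μ := by
      rw [hss.iSup_eigenspace_eq_top]
      trivial
    induction hx using Submodule.iSup_induction' with
    | mem μ x hx =>
      exact h μ x (by simpa using Module.End.mem_eigenspace_iff.1 hx)
    | zero => simp [herm]
    | add x y _ _ hx hy => rw [herm_add_left, hx, hy, add_zero]
  -- The isometry `g` preserves `⟨w, v⟩ ≠ 0`.
  have h1 : b * conj a = 1 := by
    have := SU21.herm_mulVec g w v
    rw [hw, ha, herm_smul_smul] at this
    exact mul_right_cancel₀ hwv (by rw [this, one_mul])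
  have herm_smul_self : ∀ c : ℂ, herm (c • v) v = 0 := fun c => by
    rw [herm_smul_left, hv.null, mul_zero]
  have ne_zero : ∀ n, herm n v ≠ 0 → n ≠ 0 := by
    rintro n hn rfl
    simp [herm] at hn
  by_cases hb : b * conj b = 1
  · have hab : a = b := by
      have hb0 : b ≠ 0 := left_ne_zero_of_mul_eq_one h1
      have : conj a = conj b := mul_left_cancel₀ hb0 (h1.trans hb.symm)
      exact (starRingEnd ℂ).injective this
    -- The eigenspace of `a` contains the span of `v` and `w`, where the form is indefinite.
    have hvw : herm v w ≠ 0 := fun h => hwv (herm_eq_zero_comm.1 h)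
    have hn : herm (w + (-herm w w / (2 * herm v w)) • v) v = herm w v := by
      rw [herm_add_left, herm_smul_self, add_zero]
    obtain ⟨c, hc⟩ := hv.unique (w + (-herm w w / (2 * herm v w)) • v)
      (ne_zero _ (by rwa [hn])) (by
        rw [herm_add_left, herm_add_right, herm_add_right, herm_smul_smul, hv.null,
          herm_smul_left, herm_smul_right, map_div₀, map_mul, map_neg, conj_herm, conj_herm,
          Complex.conj_ofNat]
        field_simp
        ring)
      ⟨b, by rw [Matrix.mulVec_add, Matrix.mulVec_smul, hw, ha, hab, smul_add, smul_comm]⟩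
    rw [hc, herm_smul_self] at hn
    exact hwv hn.symm
  · have hww : herm w w = 0 := by
      have := SU21.herm_mulVec g w w
      rw [hw, herm_smul_smul] at this
      by_contra h0
      exact hb (mul_right_cancel₀ h0 (by rw [this, one_mul]))
    obtain ⟨c, hc⟩ := hv.unique w (ne_zero w hwv) hww ⟨b, hw⟩
    exact hwv (by rw [hc, herm_smul_self])

/-- A square-zero matrix in dimension `3` has rank at most `1`. -/
theorem exists_forall_mulVec_eq_smul {E : Matrix (Fin 3) (Fin 3) ℂ} (h : E * E = 0) :
    ∃ x₀, ∀ x, ∃ c : ℂ, E *ᵥ x = c • (E *ᵥ x₀) := by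
  have hle : E.mulVecLin.range ≤ E.mulVecLin.ker := by
    rintro _ ⟨x, rfl⟩
    simp [Matrix.mulVec_mulVec, h]
  have h1 := E.mulVecLin.finrank_range_add_finrank_ker
  have h2 := Submodule.finrank_mono hle
  rw [Module.finrank_fin_fun] at h1
  obtain ⟨⟨_, x₀, rfl⟩, hx₀⟩ :=
    finrank_le_one_iff.1 (show Module.finrank ℂ E.mulVecLin.range ≤ 1 by omega)
  refine ⟨x₀, fun x => ?_⟩
  obtain ⟨c, hc⟩ := hx₀ ⟨_, x, rfl⟩
  exact ⟨c, (congrArg Subtype.val hc).symm⟩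

/-- The image of a square-zero matrix that commutes with `g` and with its own adjoint is a null
line fixed by `g`. -/
theorem IsUniqueNullEigenvector.exists_mulVec_eq_smul {g : SU21} {v : Fin 3 → ℂ}
    (hv : IsUniqueNullEigenvector g v) {E : Matrix (Fin 3) (Fin 3) ℂ} (h0 : E ≠ 0)
    (hE : E * E = 0) (hg : Commute E g.1.1) (hE' : Commute E (hermAdjoint E)) (x : Fin 3 → ℂ) :
    ∃ c : ℂ, E *ᵥ x = c • v := by
  obtain ⟨x₀, hx₀⟩ := exists_forall_mulVec_eq_smul hE
  have hn : E *ᵥ x₀ ≠ 0 := fun hn => h0 <| Matrix.ext_of_mulVec_single fun i => by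
    obtain ⟨c, hc⟩ := hx₀ (Pi.single i 1)
    rw [hc, hn, smul_zero, Matrix.zero_mulVec]
  have hgn : ∃ b : ℂ, g.1.1 *ᵥ (E *ᵥ x₀) = b • (E *ᵥ x₀) := by
    rw [Matrix.mulVec_mulVec, ← hg.eq, ← Matrix.mulVec_mulVec]
    exact hx₀ _
  have hnull : herm (E *ᵥ x₀) (E *ᵥ x₀) = 0 := by
    -- The adjoint acts on the image by a scalar, which vanishes as the adjoint is nilpotent.
    obtain ⟨e, he⟩ : ∃ e : ℂ, hermAdjoint E *ᵥ (E *ᵥ x₀) = e • (E *ᵥ x₀) := by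
      rw [Matrix.mulVec_mulVec, ← hE'.eq, ← Matrix.mulVec_mulVec]
      exact hx₀ _
    have h2 : hermAdjoint E *ᵥ (hermAdjoint E *ᵥ (E *ᵥ x₀)) = 0 := by
      rw [Matrix.mulVec_mulVec, ← hermAdjoint_mul, hE, hermAdjoint_zero, Matrix.zero_mulVec]
    rw [he, Matrix.mulVec_smul, he] at h2
    have he0 : e = 0 := by simpa [hn] using h2
    rw [herm_mulVec_left, he, he0]
    simp [herm]
  obtain ⟨c, hc⟩ := hv.unique _ hn hnull hgn
  obtain ⟨d, hd⟩ := hx₀ x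
  exact ⟨d * c, by rw [hd, hc, smul_smul]⟩

/-- A nonzero square-zero matrix in the double centralizer of a parabolic element is a multiple of
`x ↦ ⟨x, v⟩ v`, where `v` represents the fixed boundary point: both the matrix and its adjoint have
the line of `v` as image. -/
theorem IsUniqueNullEigenvector.exists_eq_smul_hermDyad {g : SU21} {v : Fin 3 → ℂ}
    (hv : IsUniqueNullEigenvector g v) {E : Matrix (Fin 3) (Fin 3) ℂ} (h0 : E ≠ 0)
    (hE : E * E = 0) (hcomm : ∀ B, Commute B g.1.1 → Commute B E) :
    ∃ c : ℂ, c ≠ 0 ∧ E = c • hermDyad v := by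
  have hg : Commute E g.1.1 := (hcomm _ (Commute.refl _)).symm
  have hinv : g.1.1 * hermAdjoint g.1.1 = 1 := mul_eq_one_comm.1 (SU21.hermAdjoint_mul_self g)
  have hg' : Commute (hermAdjoint E) g.1.1 := by
    have h := congrArg hermAdjoint hg.eq
    rw [hermAdjoint_mul, hermAdjoint_mul] at h
    have h' := congrArg (fun A => g.1.1 * A * g.1.1) h
    simp only [Matrix.mul_assoc, SU21.hermAdjoint_mul_self, Matrix.mul_one] at h'
    rw [← Matrix.mul_assoc, hinv, Matrix.one_mul] at h'
    exact h'
  have hE' : Commute E (hermAdjoint E) := (hcomm _ hg').symm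
  have him := hv.exists_mulVec_eq_smul h0 hE hg hE'
  have him' := hv.exists_mulVec_eq_smul (E := hermAdjoint E)
    (fun h => h0 (by rw [← hermAdjoint_hermAdjoint E, h, hermAdjoint_zero]))
    (by rw [← hermAdjoint_mul, hE, hermAdjoint_zero]) hg'
    (by rw [hermAdjoint_hermAdjoint]; exact hE'.symm)
  obtain ⟨e, -, hve⟩ := exists_null_herm_ne_zero hv.null hv.ne_zero
  obtain ⟨d, hd⟩ := him' e
  have key : ∀ x, E *ᵥ x = (conj d / herm v e) • hermDyad v *ᵥ x := by
    intro x
    obtain ⟨c, hc⟩ := him x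
    have h1 := herm_mulVec_left E x e
    rw [hc, hd, herm_smul_left, herm_smul_right] at h1
    rw [hc, hermDyad_mulVec, smul_smul]
    congr 1
    field_simp
    exact h1
  have hEq : E = (conj d / herm v e) • hermDyad v := Matrix.ext_of_mulVec_single fun i => by
    rw [key, Matrix.smul_mulVec]
  refine ⟨_, fun hc => h0 ?_, hEq⟩
  rw [hEq, hc, zero_smul]

open Polynomial in
/-- If `A` is not diagonalizable, then the algebra generated by `A ^ 3` over a field containing
the coefficients of a polynomial that vanishes at `A ^ 3` (but not at `0`) is not reduced. -/
theorem exists_aeval_sq_eq_zero {F : IntermediateField ℚ ℂ} {A : Matrix (Fin 3) (Fin 3) ℂ}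
    (hA : ¬ Module.End.IsSemisimple (Matrix.toLin' A)) {f : F[X]} (hf0 : f.coeff 0 ≠ 0)
    (hf : aeval (A ^ 3) f = 0) :
    ∃ P : F[X], aeval (A ^ 3) P ≠ 0 ∧ aeval (A ^ 3) P * aeval (A ^ 3) P = 0 := by
  have hfne : f ≠ 0 := by
    rintro rfl
    simp at hf0
  obtain ⟨q, n, hq, hqf, hfq⟩ := exists_squarefree_dvd_pow_of_ne_zero hfne
  have hnil : IsNilpotent (aeval (A ^ 3) q) := by
    obtain ⟨r, hr⟩ := hfq
    exact ⟨n, by rw [← map_pow, hr, map_mul, hf, zero_mul]⟩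
  have hne : aeval (A ^ 3) q ≠ 0 := by
    intro h
    -- Otherwise `q (X ^ 3)` is a squarefree polynomial over `ℂ` that vanishes at `A`.
    have hsep : q.Separable := PerfectField.separable_iff_squarefree.2 hq
    have hX : IsCoprime q X := by
      exact (irreducible_X.coprime_iff_not_dvd.2 fun h => hf0 (X_dvd_iff.1 (h.trans hqf))).symm
    -- Cubing is unramified away from `0`, and `q` does not vanish at `0`.
    have hsep3 : (expand F 3 q).Separable := by
      rw [separable_def, derivative_expand]
      refine IsCoprime.mul_right ((separable_def q).1 hsep |>.map (expand F 3 : F[X] →+* F[X])) ?_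
      have h1 : IsCoprime (expand F 3 q) (X ^ 3) := by
        simpa using hX.map (expand F 3 : F[X] →+* F[X])
      have h2 : IsCoprime (expand F 3 q) (X : F[X]) := (IsCoprime.pow_right_iff (by norm_num)).1 h1
      have h3 : IsUnit ((3 : ℕ) : F[X]) := by
        rw [← C_eq_natCast]
        exact isUnit_C.2 (isUnit_iff_ne_zero.2 (by norm_num))
      exact IsCoprime.mul_right (isCoprime_one_right.of_isCoprime_of_dvd_right h3.dvd) h2.pow_right
    refine hA (Module.End.isSemisimple_of_squarefree_aeval_eq_zero
      (hsep3.map (f := algebraMap F ℂ)).squarefree ?_)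
    have h4 : aeval A ((expand F 3 q).map (algebraMap F ℂ)) = 0 := by
      rw [aeval_map_algebraMap, expand_aeval, h]
    have h5 := aeval_algHom_apply (Matrix.toLinAlgEquiv' (R := ℂ) (n := Fin 3)).toAlgHom A
      ((expand F 3 q).map (algebraMap F ℂ))
    rw [h4, map_zero] at h5
    exact h5
  obtain ⟨m, hm, hm'⟩ : ∃ m, aeval (A ^ 3) q ^ (m + 1) = 0 ∧ aeval (A ^ 3) q ^ m ≠ 0 := by
    classical
    have hpos : Nat.find hnil ≠ 0 := fun h => by
      have := Nat.find_spec hnil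
      rw [h, pow_zero] at this
      exact one_ne_zero this
    refine ⟨Nat.find hnil - 1, ?_, Nat.find_min hnil (by omega)⟩
    rw [Nat.sub_add_cancel (Nat.one_le_iff_ne_zero.2 hpos)]
    exact Nat.find_spec hnil
  have hm0 : m ≠ 0 := by
    rintro rfl
    exact hne (by simpa using hm)
  refine ⟨q ^ m, by rwa [map_pow], ?_⟩
  rw [map_pow, ← pow_add, show m + m = (m + 1) + (m - 1) by omega, pow_add, hm, zero_mul]

/-! ### The trace field contains the invariants -/

/-- The Cayley–Hamilton theorem in dimension `3`. -/
theorem cayley_hamilton_three (A : Matrix (Fin 3) (Fin 3) ℂ) :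
    A ^ 3 - A.trace • A ^ 2 + A.adjugate.trace • A - A.det • 1 = 0 := by
  rw [Matrix.adjugate_fin_three]
  ext i j
  fin_cases i <;> fin_cases j <;>
    simp [pow_succ, Matrix.mul_apply, Fin.sum_univ_three, Matrix.trace, Matrix.det_fin_three] <;>
    ring

theorem SU21.coe_pow_three (g : SU21) : (g ^ 3).1.1 = g.1.1 ^ 3 := by
  rw [SubgroupClass.coe_pow]
  exact Matrix.SpecialLinearGroup.coe_pow _ _

theorem SU21.coe_inv (g : SU21) : (g⁻¹).1.1 = g.1.1.adjugate := by
  rw [InvMemClass.coe_inv]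
  exact Matrix.SpecialLinearGroup.coe_inv _

/-- The matrix algebra generated by a subgroup of `SU(2,1)` over its trace field. -/
noncomputable def traceAlgebra (G : Subgroup SU21) :
    Subalgebra (traceField G) (Matrix (Fin 3) (Fin 3) ℂ) :=
  Algebra.adjoin (traceField G) {A | ∃ g ∈ G, A = g.1.1}

theorem trace_mem_of_mem_traceAlgebra {G : Subgroup SU21} {A : Matrix (Fin 3) (Fin 3) ℂ}
    (hA : A ∈ traceAlgebra G) : A.trace ∈ traceField G := by
  let M : Submonoid (Matrix (Fin 3) (Fin 3) ℂ) :=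
    { carrier := {A | ∃ g ∈ G, A = g.1.1}
      one_mem' := ⟨1, G.one_mem, rfl⟩
      mul_mem' := by
        rintro _ _ ⟨g, hg, rfl⟩ ⟨h, hh, rfl⟩
        exact ⟨g * h, G.mul_mem hg hh, rfl⟩ }
  have hA' : A ∈ Submodule.span (traceField G) (M : Set (Matrix (Fin 3) (Fin 3) ℂ)) := by
    rw [← Submonoid.closure_eq M, ← Algebra.adjoin_eq_span]
    exact hA
  clear hA
  induction hA' using Submodule.span_induction with
  | mem A hA =>
    obtain ⟨g, hg, rfl⟩ := hA
    exact IntermediateField.subset_adjoin ℚ _ ⟨g, hg, rfl⟩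
  | zero => simp
  | add A B _ _ hA hB =>
    rw [Matrix.trace_add]
    exact add_mem hA hB
  | smul c A _ hA =>
    rw [Matrix.trace_smul, IntermediateField.smul_def]
    exact mul_mem c.2 hA

open Polynomial in
/-- For a fixed point `p` of a parabolic element of `Γ`, the algebra generated by the cubes of the
lifts of the elements of `Γ` over the field `k(Γ)` contains a multiple of `x ↦ ⟨x, p⟩ p`. -/
theorem IsParabolicFixedPoint.exists_smul_hermDyad_mem {Γ : Subgroup PU21} {p : HBoundary}
    (hp : IsParabolicFixedPoint Γ p) :
    ∃ c : ℂ, c ≠ 0 ∧ c • hermDyad p.1.rep ∈ traceAlgebra (cubeSubgroup (lifts Γ)) := by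
  obtain ⟨γ, hγ, hpar, hfix⟩ := hp
  obtain ⟨g, rfl⟩ := toPU21_surjective γ
  have hv := hpar.isUniqueNullEigenvector hfix
  set G := cubeSubgroup (lifts Γ)
  have hG : g ^ 3 ∈ G := Subgroup.subset_closure ⟨g, hγ, rfl⟩
  have ht : (g.1.1 ^ 3).trace ∈ traceField G :=
    IntermediateField.subset_adjoin ℚ _ ⟨g ^ 3, hG, by rw [SU21.coe_pow_three]⟩
  have ht' : (g.1.1 ^ 3).adjugate.trace ∈ traceField G :=
    IntermediateField.subset_adjoin ℚ _ ⟨(g ^ 3)⁻¹, G.inv_mem hG, by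
      rw [SU21.coe_inv, SU21.coe_pow_three]⟩
  let f : (traceField G)[X] := X ^ 3 - C ⟨_, ht⟩ * X ^ 2 + C ⟨_, ht'⟩ * X - 1
  have hf0 : f.coeff 0 ≠ 0 := by simp [f]
  have hf : aeval (g.1.1 ^ 3) f = 0 := by
    have h := cayley_hamilton_three (g.1.1 ^ 3)
    have hdet : (g.1.1 ^ 3).det = 1 := by
      rw [← SU21.coe_pow_three]
      exact (g ^ 3).1.2
    rw [hdet, one_smul] at h
    simp only [f, map_sub, map_add, map_mul, map_pow, aeval_X, aeval_C, map_one,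
      ← Algebra.smul_def]
    exact h
  obtain ⟨P, hP, hP'⟩ := exists_aeval_sq_eq_zero hv.not_isSemisimple hf0 hf
  obtain ⟨c, hc, h⟩ := hv.exists_eq_smul_hermDyad hP hP' fun B hB =>
    Algebra.commute_of_mem_adjoin_singleton_of_commute (aeval_mem_adjoin_singleton _ _)
      (hB.pow_right 3)
  refine ⟨c, hc, ?_⟩
  rw [← h]
  have hsub : ({g.1.1 ^ 3} : Set (Matrix (Fin 3) (Fin 3) ℂ)) ⊆ {A | ∃ g ∈ G, A = g.1.1} :=
    Set.singleton_subset_iff.2 ⟨g ^ 3, hG, (SU21.coe_pow_three g).symm⟩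
  exact Algebra.adjoin_mono hsub (aeval_mem_adjoin_singleton _ _)

/-- The invariant as a quotient of sums of products of Hermitian products along cycles. -/
theorem vertexInvariant_eq_cycles {p q r s : Fin 3 → ℂ} (hp : herm p p = 0)
    (hq : herm q q = 0) (hr : herm r r = 0) (hpq : herm p q ≠ 0) (hps : herm p s ≠ 0)
    (hD : det3 p q r ≠ 0) :
    vertexInvariant p q r s =
      (herm p q * herm q r * herm r p * (herm p s * herm s p)
        + herm p r * herm r p * (herm p s * herm s q * herm q p)
        - herm p q * herm q p * (herm p s * herm s r * herm r p)) /
      ((herm p q * herm q r * herm r p + herm p r * herm r q * herm q p) *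
        (herm p s * herm s p)) := by
  have hD' : conj (det3 p q r) ≠ 0 := by simpa using hD
  have h1 := det3_mul_conj_det3 p q r p q r
  have h2 := det3_mul_conj_det3 p q s p q r
  simp only [Matrix.det_fin_three, Matrix.of_apply, Matrix.cons_val, hp, hq, hr] at h1 h2
  have hden : herm p q * herm q r * herm r p + herm p r * herm r q * herm q p ≠ 0 := by
    intro h
    refine mul_ne_zero hD hD' ?_
    rw [h1]
    linear_combination -h
  have hsp : herm s p ≠ 0 := fun h => hps (herm_eq_zero_comm.1 h)
  rw [vertexInvariant_eq_det3 hp hpq, div_eq_div_iff (mul_ne_zero hD hsp)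
    (mul_ne_zero hden (mul_ne_zero hps hsp))]
  refine mul_right_cancel₀ hD' ?_
  linear_combination
    (herm r p * (herm p q * herm q r * herm r p + herm p r * herm r q * herm q p) *
      (herm p s * herm s p)) * h2 -
    ((herm p q * herm q r * herm r p * (herm p s * herm s p)
        + herm p r * herm r p * (herm p s * herm s q * herm q p)
        - herm p q * herm q p * (herm p s * herm s r * herm r p)) * herm s p) * h1

/-- The invariants of a generic quadruple of fixed points of parabolic elements are in the
field `k(Γ)`: up to factors which cancel, the products along cycles are the traces of products
of elements of the trace algebra. -/
theorem vertexInvariant_mem_cubeTraceField {Γ : Subgroup PU21} {x : Fin 4 → HBoundary}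
    (hx : GenericPosition x) (hpar : ∀ v, IsParabolicFixedPoint Γ (x v)) {a b c d : Fin 4}
    (hab : a ≠ b) (hac : a ≠ c) (had : a ≠ d) (hbc : b ≠ c) :
    vertexInvariant (x a).1.rep (x b).1.rep (x c).1.rep (x d).1.rep ∈ cubeTraceField Γ := by
  choose m hm0 hm using fun v => (hpar v).exists_smul_hermDyad_mem
  have h2 : ∀ i j, m i * m j *
      (herm (x i).1.rep (x j).1.rep * herm (x j).1.rep (x i).1.rep) ∈ cubeTraceField Γ := by
    intro i j
    have := trace_mem_of_mem_traceAlgebra (mul_mem (hm i) (hm j))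
    rw [Matrix.smul_mul, Matrix.mul_smul, Matrix.trace_smul, Matrix.trace_smul,
      trace_hermDyad_mul, smul_eq_mul, smul_eq_mul, ← mul_assoc] at this
    exact this
  have h3 : ∀ i j l, m i * m j * m l * (herm (x i).1.rep (x j).1.rep *
      herm (x j).1.rep (x l).1.rep * herm (x l).1.rep (x i).1.rep) ∈ cubeTraceField Γ := by
    intro i j l
    have : _ ∈ cubeTraceField Γ :=
      trace_mem_of_mem_traceAlgebra (mul_mem (mul_mem (hm i) (hm l)) (hm j))
    simp only [Matrix.smul_mul, Matrix.mul_smul, Matrix.trace_smul,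
      trace_hermDyad_mul_mul, smul_eq_mul] at this
    convert this using 1
    ring
  have key := div_mem
    (sub_mem (add_mem (mul_mem (h3 a b c) (h2 a d)) (mul_mem (h2 a c) (h3 a d b)))
      (mul_mem (h2 a b) (h3 a d c)))
    (mul_mem (add_mem (h3 a b c) (h3 a c b)) (h2 a d))
  rw [vertexInvariant_eq_cycles (x a).herm_self (x b).herm_self (x c).herm_self
    (hx.herm_ne_zero hab) (hx.herm_ne_zero had) (hx.det3_ne_zero hab hbc hac),
    ← mul_div_mul_left _ _ (show m a ^ 2 * m b * m c * m d ≠ 0 by simp [hm0])]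
  convert key using 1
  congr 1 <;> ring

theorem mainTheorem2 {τ : Type*} [Finite τ] (T : IdealTriangulation τ) (x₀ : T.Space)
    (ρ : FundamentalGroup T.Space x₀ →* PU21) (R : T.Realization) (hρ : R.IsCompatible ρ) :
    cubeTraceField ρ.range ≤ R.invariantField ∧
      ((∀ t v, IsParabolicFixedPoint ρ.range (R.vertex t v)) → IsZariskiDense ρ.range →
        R.invariantField = cubeTraceField ρ.range) := by
  obtain ⟨⟨t₀, -⟩, -⟩ := Quot.exists_rep x₀
  have hle : cubeTraceField ρ.range ≤ R.invariantField := by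
    rw [show ρ.range = _ from hρ]
    exact R.cubeTraceField_le t₀
  refine ⟨hle, fun hpar _ => le_antisymm (IntermediateField.adjoin_le_iff.2 ?_) hle⟩
  rintro _ ⟨t, j, rfl⟩
  have h := @vertexInvariant_mem_cubeTraceField _ _ (R.generic t) (hpar t)
  fin_cases j
  · exact h (a := 0) (b := 1) (c := 2) (d := 3) (by decide) (by decide) (by decide) (by decide)
  · exact h (a := 1) (b := 0) (c := 3) (d := 2) (by decide) (by decide) (by decide) (by decide)
  · exact h (a := 2) (b := 3) (c := 0) (d := 1) (by decide) (by decide) (by decide) (by decide)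
  · exact h (a := 3) (b := 2) (c := 1) (d := 0) (by decide) (by decide) (by decide) (by decide)
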